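/- Let $\ell\ge 1$, let $a_1,\dots,a_\ell\ge 1$ and $t_1,\dots,t_\ell\ge 2$ be integers, and let $$\mathbf k=(k_1,\dots,k_n)=(\underbrace{1,\dots,1}_{a_1-1},t_1,\ \dots,\ \underbrace{1,\dots,1}_{a_\ell-1},t_\ell)$$ (that is, $\mathbf k$ has length $\ell$ and weight $(a_1,\dots,a_\ell;t_1,\dots,t_\ell;0)$). Put $K=k_1+\dots+k_n$ and $M=\max(a_1,\dots,a_\ell)$. **Stirling polynomials.** A Stirling permutation of the multiset $\{1^{k_1},\dots,n^{k_n}\}$ is an arrangement $\sigma(1)\cdots\sigma(K)$ of its elements such that $\sigma(s)\ge\sigma(i)$ whenever $\sigma(i)=\sigma(j)$ and $i<s<j$. An index $i$ is a descent of $\sigma$ if $i=K$, or $i<K$ and $\sigma(i)>\sigma(i+1)$. Let $A_{\mathbf k,i}$ be the number of these Stirling permutations with exactly $i$ descents, and define $B_{\mathbf k}(m)$, $b_{\mathbf k}(m)$ by $$\sum_{m\ge0}B_{\mathbf k}(m)x^m=\frac{\sum_{i=1}^{n}A_{\mathbf k,i}x^i}{(1-x)^{K+1}},\qquad \sum_{m\ge0}b_{\mathbf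 k}(m)x^m=\frac{\sum_{i=K-n+1}^{K}A_{\mathbf k,K+1-i}x^i}{(1-x)^{K+1}}.$$ **Systems.** Write $[N]=\{1,\dots,N\}$. For a family $\mathcal F$ of nonempty sets or multisets of integers, let $\min(\mathcal F)$ be the set of the minimal elements of its blocks, write $x\sim_{\mathcal F}y$ if some block contains both $x$ and $y$, and let $\mathrm{multiset}(\mathcal F)$ be the merge sum $\uplus_{B\in\mathcal F}B$ of the blocks. A family of sets or multisets with elements in $[N+1]$ is segmented if, for all $x<y<z$ in $[N+1]$, $x\sim_{\mathcal F}z$ implies $y\in\min(\mathcal F)$. For a permutation $\sigma$ of $[N]$ let $\mathrm{lmin}(\sigma)$ be the set of its left-to-right minima. For $D\subseteq[N]$ with $|[N]\setminus D|=\ell$ write $[N]\setminus D=\{x_1<\dots<x_\ell\}$ and put $$R(D)=D\uplus\{x_1,\,x_2^{t_1-2},\,\dots,\,x_\ell^{t_{\ell-1}-2},\,(N+1)^{t_\ell-2}\}.$$ For $N-m=\ell$, $S_{\mathbf k}(N,m)$ is the number of $\mathbf k$-partition systems of $[N]$ into $m$ blocks, i.e. of tuples $(\pi_0,\pi_1,\dots,\pi_M)$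 such that: $\pi_1,\dots,\pi_M$ are partitions of $[N]$ with the same set $D$ of block minima, $|D|=m$; $x_i\sim_{\pi_j}1$ whenever $a_i<j\le M$; and $\pi_0$ is a segmented family of nonempty multisets with $\min(\pi_0)=D$, $x_1\sim_{\pi_0}1$ and $\mathrm{multiset}(\pi_0)\subseteq R(D)$. For $N-m=\ell$, $s_{\mathbf k}(N,m)$ is the number of $\mathbf k$-permutation systems of $[N]$ having $m$ left-to-right minima, i.e. of tuples $(\sigma_0,\sigma_1,\dots,\sigma_M)$ such that: $\sigma_1,\dots,\sigma_M$ are permutations of $[N]$ with the same set $D$ of left-to-right minima, $|D|=m$; whenever $a_i<j\le M$, all entries of $\sigma_j$ to the right of $x_i$ are greater than $x_i$; and $\sigma_0$ is a segmented family of nonempty sets with $\min(\sigma_0)=D$, $x_1\sim_{\sigma_0}1$ and $\mathrm{multiset}(\sigma_0)=R(D)$. **Theorem.** For every integer $m\ge0$, $$B_{\mathbf k}(m)=S_{\mathbf k}(\ell+m,m)=\sum_{1\le i_1\le\dots\le i_\ell\le m}\ \prod_{j=1}^{\ell} i_j^{a_j}\binom{t_j+i_{j+1}-i_j-2}{i_{j+1}-i_j},$$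 and for every integer $m\ge\ell$, $$b_{\mathbf k}(m)=s_{\mathbf k}(m,m-\ell)=\sum_{1\le i_1<\dots<i_\ell<m}\ \prod_{j=1}^{\ell} i_j^{a_j}\binom{i_{j+1}-i_j-1}{t_j-2},$$ where $i_{\ell+1}=m$ in both sums. For $0\le m<\ell$ (where $s_{\mathbf k}(m,m-\ell)$ has no meaning) both $b_{\mathbf k}(m)$ and the last sum are $0$. -/

import Mathlib

namespace KStirling

/-! ### Stirling permutations of multisets and Stirling polynomials -/

/-- The multiset `{1^{k₁}, …, n^{kₙ}}` of type `k = (k₁, …, kₙ)`. -/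
def multisetOfType (k : List ℕ) : Multiset ℕ :=
  ∑ i : Fin k.length, Multiset.replicate k[i] (i.val + 1)

/-- `w` is a Stirling permutation of the multiset of type `k`: an arrangement of all its elements
in a word such that everything between two equal letters is at least as large as these. -/
def IsStirlingPerm (k w : List ℕ) : Prop :=
  (w : Multiset ℕ) = multisetOfType k ∧
    ∀ (i s j : ℕ) (his : i < s) (hsj : s < j) (hj : j < w.length), w[i] = w[j] → w[i] ≤ w[s]

/-- The descent positions (counted from `0`) of a word; the last position always is a descent. -/
def descents (w : List ℕ) : Finset (Fin w.length) :=
  {i | ∀ h : i.val + 1 < w.length, w[i.val + 1] < w[i]}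

/-- The Eulerian number `A_{k,i}`. -/
noncomputable def eulerian (k : List ℕ) (i : ℕ) : ℕ :=
  {w : List ℕ | IsStirlingPerm k w ∧ (descents w).card = i}.ncard

open PowerSeries in
/-- The power series of `G_k(x) = (∑_{i=1}^n A_{k,i} x^i) / (1-x)^{K+1}`, with `K = k₁ + ⋯ + kₙ`. -/
noncomputable def G (k : List ℕ) : PowerSeries ℚ :=
  (∑ i ∈ Finset.Icc 1 k.length, (eulerian k i : PowerSeries ℚ) * X ^ i) *
    ((1 - X) ^ (k.sum + 1))⁻¹

open PowerSeries in
/-- The power series of `g_k(x) = (∑_{i=K-n+1}^K A_{k,K+1-i} x^i) / (1-x)^{K+1}`. -/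
noncomputable def g (k : List ℕ) : PowerSeries ℚ :=
  (∑ i ∈ Finset.Icc (k.sum - k.length + 1) k.sum,
      (eulerian k (k.sum + 1 - i) : PowerSeries ℚ) * X ^ i) *
    ((1 - X) ^ (k.sum + 1))⁻¹

/-- The Stirling polynomial `B_k`, at `m`. -/
noncomputable def B (k : List ℕ) (m : ℕ) : ℚ := PowerSeries.coeff m (G k)

/-- The Stirling polynomial `b_k`, at `m`. -/
noncomputable def b (k : List ℕ) (m : ℕ) : ℚ := PowerSeries.coeff m (g k)

/-- `k` has length `ℓ` and weight `(a₁, …, a_ℓ; t₁, …, t_ℓ; r)`: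
it is the concatenation of the blocks `(1, …, 1, tᵢ)` of `aᵢ` entries each (`aᵢ > 0`, `tᵢ > 1`),
followed by `r` ones. -/
def HasWeight {ℓ : ℕ} (k : List ℕ) (a t : Fin ℓ → ℕ) (r : ℕ) : Prop :=
  (∀ i, 0 < a i) ∧ (∀ i, 1 < t i) ∧
    k = (List.ofFn fun i => List.replicate (a i - 1) 1 ++ [t i]).flatten ++ List.replicate r 1

/-! ### Families of sets and multisets

A set is regarded as a multiset without repeated elements. -/

/-- The set `min(F)` of the minimal elements of the blocks of `F`. -/
def famMin (F : Finset (Multiset ℕ)) : Set ℕ :=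
  {x | ∃ C ∈ F, IsLeast {y | y ∈ C} x}

/-- `x ∼_F y`: some block of `F` contains both `x` and `y`. -/
def famRel (F : Finset (Multiset ℕ)) (x y : ℕ) : Prop :=
  ∃ C ∈ F, x ∈ C ∧ y ∈ C

/-- The merge sum of the blocks of `F`. -/
def famSum (F : Finset (Multiset ℕ)) : Multiset ℕ := ∑ C ∈ F, C

/-- `F` is a segmented family over `U`. -/
def Segmented (U : Finset ℕ) (F : Finset (Multiset ℕ)) : Prop :=
  (∀ C ∈ F, ∀ x ∈ C, x ∈ U) ∧
    ∀ x ∈ U, ∀ y ∈ U, ∀ z ∈ U, x < y → y < z → famRel F x z → y ∈ famMin F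

/-- The family of the blocks of a partition. -/
def blocks {s : Finset ℕ} (π : Finpartition s) : Finset (Multiset ℕ) :=
  π.parts.map ⟨Finset.val, Finset.val_injective⟩

/-- The sequence `(y₁, …, y_ℓ)` prolonged by `y_{ℓ+1} = e`. -/
def prolong {ℓ : ℕ} (y : Fin ℓ → ℕ) (e : ℕ) : Fin (ℓ + 1) → ℕ := Fin.snoc y e

/-- The multiset `D ⊎ {x₁, x₂^{t₁-2}, …, x_ℓ^{t_{ℓ-1}-2}, (n+1)^{t_ℓ-2}}`. -/
def supply {ℓ : ℕ} (t : Fin ℓ → ℕ) (n : ℕ) (D : Finset ℕ) (x : Fin ℓ → ℕ) : Multiset ℕ :=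
  D.val + ({prolong x (n + 1) 0} +
    ∑ j : Fin ℓ, Multiset.replicate (t j - 2) (prolong x (n + 1) j.succ))

/-- `x₁ < ⋯ < x_ℓ` are the elements of `[n]` outside `D`. -/
def Enumerates {ℓ : ℕ} (n : ℕ) (D : Finset ℕ) (x : Fin ℓ → ℕ) : Prop :=
  StrictMono x ∧ Finset.univ.image x = Finset.Icc 1 n \ D

/-- The number `M = max(a₁, …, a_ℓ)`. -/
def maxA {ℓ : ℕ} (a : Fin ℓ → ℕ) : ℕ := Finset.univ.sup a

/-- `(π₀, π₁, …, π_M)` is a `k`-partition system of `[n]` into `m` blocks, where `k` has weight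
`(a₁, …, a_ℓ; t₁, …, t_ℓ; 0)`, `ℓ = n - m ≥ 1`. The partition `π_{j+1}` is written `π j`
(`0 ≤ j < M`), and `D` is the common set of block minima of `π₁, …, π_M`. -/
def IsPartitionSystem {ℓ : ℕ} (a t : Fin ℓ → ℕ) (n m : ℕ) (π₀ : Finset (Multiset ℕ))
    (π : Fin (maxA a) → Finpartition (Finset.Icc 1 n)) : Prop :=
  ∃ (D : Finset ℕ) (x : Fin ℓ → ℕ),
    (∀ j, famMin (blocks (π j)) = D) ∧ D.card = m ∧ Enumerates n D x ∧
    (∀ i j, a i < j.val + 1 → famRel (blocks (π j)) (x i) 1) ∧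
    (∀ C ∈ π₀, C ≠ 0) ∧ Segmented (Finset.Icc 1 (n + 1)) π₀ ∧ famMin π₀ = D ∧
    famRel π₀ (prolong x (n + 1) 0) 1 ∧ famSum π₀ ≤ supply t n D x

/-- The number `S_k(n, m)` of `k`-partition systems of `[n]` into `m` blocks. -/
noncomputable def partitionSystems {ℓ : ℕ} (a t : Fin ℓ → ℕ) (n m : ℕ) : ℕ :=
  {p : Finset (Multiset ℕ) × (Fin (maxA a) → Finpartition (Finset.Icc 1 n)) |
    IsPartitionSystem a t n m p.1 p.2}.ncard

/-- The set of left-to-right minima of a permutation of `[n]`; the permutation is given on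
`{0, …, n-1}`, so that its letter at a position `p` is `σ p + 1`. -/
def lmin {n : ℕ} (σ : Equiv.Perm (Fin n)) : Set ℕ :=
  {v | ∃ p, v = (σ p).val + 1 ∧ ∀ q, q < p → σ p < σ q}

/-- `(σ₀, σ₁, …, σ_M)` is a `k`-permutation system of `[n]` having `m` left-to-right minima, where
`k` has weight `(a₁, …, a_ℓ; t₁, …, t_ℓ; 0)`, `ℓ = n - m ≥ 1`. The permutation `σ_{j+1}` is written
`σ j` (`0 ≤ j < M`), and `D` is the common set of left-to-right minima of `σ₁, …, σ_M`. -/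
def IsPermutationSystem {ℓ : ℕ} (a t : Fin ℓ → ℕ) (n m : ℕ) (σ₀ : Finset (Multiset ℕ))
    (σ : Fin (maxA a) → Equiv.Perm (Fin n)) : Prop :=
  ∃ (D : Finset ℕ) (x : Fin ℓ → ℕ),
    (∀ j, lmin (σ j) = D) ∧ D.card = m ∧ Enumerates n D x ∧
    (∀ i j, a i < j.val + 1 →
      ∀ p, (σ j p).val + 1 = x i → ∀ q, p < q → x i < (σ j q).val + 1) ∧
    (∀ C ∈ σ₀, C ≠ 0 ∧ C.Nodup) ∧ Segmented (Finset.Icc 1 (n + 1)) σ₀ ∧ famMin σ₀ = D ∧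
    famRel σ₀ (prolong x (n + 1) 0) 1 ∧ famSum σ₀ = supply t n D x

/-- The number `s_k(n, m)` of `k`-permutation systems of `[n]` having `m` left-to-right minima. -/
noncomputable def permutationSystems {ℓ : ℕ} (a t : Fin ℓ → ℕ) (n m : ℕ) : ℕ :=
  {p : Finset (Multiset ℕ) × (Fin (maxA a) → Equiv.Perm (Fin n)) |
    IsPermutationSystem a t n m p.1 p.2}.ncard

/-! ### The explicit sums -/

/-- The weakly increasing sequences `1 ≤ i₁ ≤ ⋯ ≤ i_ℓ ≤ m`. -/
def weakSeqs (ℓ m : ℕ) : Finset (Fin ℓ → ℕ) :=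
  {i ∈ Fintype.piFinset fun _ => Finset.Icc 1 m | ∀ p q, p < q → i p ≤ i q}

/-- The strictly increasing sequences `1 ≤ i₁ < ⋯ < i_ℓ < m`. -/
def strictSeqs (ℓ m : ℕ) : Finset (Fin ℓ → ℕ) :=
  {i ∈ Fintype.piFinset fun _ => Finset.Ico 1 m | ∀ p q, p < q → i p < i q}

end KStirling

/-! Both sides of each identity are computed and found equal to the explicit sum.

Stirling polynomials: in a Stirling permutation the copies of the largest letter are adjacent, so
each one of type `k ++ [t]` arises exactly once by inserting a block of `t` new letters into one of
the K+1 gaps of one of type `k`. If the latter has d descents, d gaps preserve this number and K+1-d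
gaps raise it by one (`sum_desc_insertLetters`, `sum_stirlingPerms_append`). The same coefficients
appear when θ = x d/dx is applied to x^d/(1-x)^(K+1). Hence appending `t` acts on the series as θ
followed by multiplication by (1-x)^(-(t-1)), or by (x/(1-x))^(t-1) for the reversed numerator. A
block (1,…,1,t) of a entries therefore multiplies the i-th coefficient by i^a and convolves with
binomial coefficients; iteration gives the sums (`coeff_descSeries_listOfWeight`,
`coeff_codescSeries_listOfWeight`).

Systems: once the nonminima x_1 < … < x_ℓ are fixed, all components are independent. A partition
amounts to a smaller block minimum for each x_i (`ncard_partitions_of_famMin`), a permutation to the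
number of smaller letters left of each letter (`ncard_permutations_of_lmin`), and a segmented family
to the number of copies of the next nonminimum that each element of D receives
(`exists_eq_segFamily`), which is constrained separately in each gap between nonminima. Summation
over x and the substitution i_j = x_j - j for partitions, i_j = x_j - 1 for permutations, give the
same sums. -/

namespace KStirling

/-! ### Stirling permutations by insertion of the largest letter -/

/-- A word is Stirling if all letters between two equal letters are at least as large as these. -/
def IsStirlingWord (w : List ℕ) : Prop := ∀ x y, List.Sublist [x, y, x] w → x ≤ y

/-- The sublist form passes to subwords and filtered words at once, so that insertion and deletion
of letters need no index arithmetic. -/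
theorem isStirlingWord_iff (w : List ℕ) : IsStirlingWord w ↔
    ∀ (i s j : ℕ) (his : i < s) (hsj : s < j) (hj : j < w.length), w[i] = w[j] → w[i] ≤ w[s] := by
  constructor
  · intro h i s j his hsj hj hij
    apply h
    rw [List.sublist_iff_exists_fin_orderEmbedding_get_eq]
    refine ⟨OrderEmbedding.ofStrictMono
      ![⟨i, by omega⟩, ⟨s, by omega⟩, ⟨j, hj⟩] ?_, ?_⟩
    · intro p q hpq
      fin_cases p <;> fin_cases q <;> simp_all
      omega
    · intro p
      fin_cases p
      exacts [rfl, rfl, hij]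
  · intro h x y hxy
    rw [List.sublist_iff_exists_fin_orderEmbedding_get_eq] at hxy
    obtain ⟨f, hf⟩ := hxy
    have h0 := hf ⟨0, by simp⟩
    have h1 := hf ⟨1, by simp⟩
    have h2 := hf ⟨2, by simp⟩
    simp only [List.get_eq_getElem] at h0 h1 h2
    have := h (f ⟨0, by simp⟩) (f ⟨1, by simp⟩) (f ⟨2, by simp⟩)
      (f.strictMono (by simp)) (f.strictMono (by simp)) (Fin.is_lt _)
      (by rw [← h0, ← h2]; rfl)
    rw [← h0, ← h1] at this
    exact this

theorem multisetOfType_append (k : List ℕ) (t : ℕ) :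
    multisetOfType (k ++ [t]) = multisetOfType k + Multiset.replicate t (k.length + 1) := by
  have key : ∀ l : List ℕ, multisetOfType l =
      ∑ i ∈ Finset.range l.length, Multiset.replicate (l.getD i 0) (i + 1) := by
    intro l
    rw [Finset.sum_range, multisetOfType]
    refine Finset.sum_congr rfl fun i _ => ?_
    simp [List.getD_eq_getElem?_getD]
  rw [key, key, List.length_append, List.length_singleton, Finset.sum_range_succ]
  congr 1
  · refine Finset.sum_congr rfl fun i hi => ?_
    rw [Finset.mem_range] at hi
    simp [List.getD_eq_getElem?_getD, List.getElem?_append_left hi]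
  · simp [List.getD_eq_getElem?_getD]

theorem le_length_of_mem_multisetOfType {k : List ℕ} {x : ℕ} (hx : x ∈ multisetOfType k) :
    x ≤ k.length := by
  rw [multisetOfType, Multiset.mem_sum] at hx
  obtain ⟨i, -, hi⟩ := hx
  have := Multiset.eq_of_mem_replicate hi
  omega

theorem card_multisetOfType (k : List ℕ) : (multisetOfType k).card = k.sum := by
  rw [multisetOfType, Multiset.card_sum]
  simp [Fin.sum_univ_getElem]

/-- The word obtained from `w` by inserting `t` letters `N` after the first `p` letters. -/
def insertLetters (N t : ℕ) (w : List ℕ) (p : ℕ) : List ℕ :=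
  w.take p ++ (List.replicate t N ++ w.drop p)

theorem filter_insertLetters {N t p : ℕ} {w : List ℕ} (hw : ∀ x ∈ w, x < N) :
    (insertLetters N t w p).filter (· ≠ N) = w := by
  have h : ∀ l : List ℕ, (∀ x ∈ l, x < N) → l.filter (· ≠ N) = l := by
    intro l hl
    rw [List.filter_eq_self]
    intro x hx
    simpa using (hl x hx).ne
  rw [insertLetters, List.filter_append, List.filter_append,
    h _ fun x hx => hw x (List.mem_of_mem_take hx), h _ fun x hx => hw x (List.mem_of_mem_drop hx)]
  simp

/-- A forbidden pattern x y x with y < x cannot use the new letters: y = N is too large, and x = N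
would force y into the contiguous block of N's. So it would already occur in `w`. -/
theorem isStirlingWord_insertLetters {N t p : ℕ} {w : List ℕ} (hw : ∀ x ∈ w, x < N)
    (h : IsStirlingWord w) : IsStirlingWord (insertLetters N t w p) := by
  intro x y hxy
  have hmem : ∀ z ∈ insertLetters N t w p, z ≤ N := by
    intro z hz
    simp only [insertLetters, List.mem_append, List.mem_replicate] at hz
    rcases hz with hz | ⟨_, hz⟩ | hz
    · exact (hw z (List.mem_of_mem_take hz)).le
    · exact hz.le
    · exact (hw z (List.mem_of_mem_drop hz)).le
  have hxN : x ≤ N := hmem x (hxy.subset (by simp))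
  by_cases hy : y = N
  · omega
  by_cases hx : x = N
  · exfalso
    subst hx
    rw [insertLetters, List.sublist_append_iff] at hxy
    obtain ⟨l₁, l₂, he, h₁, h₂⟩ := hxy
    have hl₁ : l₁ = [] := by
      rcases l₁ with - | ⟨z, l₁⟩
      · rfl
      · simp only [List.cons_append, List.cons.injEq] at he
        have := hw z (List.mem_of_mem_take (h₁.subset (by simp)))
        omega
    subst hl₁
    rw [List.nil_append] at he
    rw [← he, List.sublist_append_iff] at h₂
    obtain ⟨l₃, l₄, he', h₃, h₄⟩ := h₂
    have hl₄ : l₄ = [] := by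
      by_contra hne
      have h5 : l₄.getLast hne = x := by
        have : (l₃ ++ l₄).getLast (by simp [hne]) = x := by simp [← he']
        rwa [List.getLast_append_of_ne_nil _ hne] at this
      have := hw x (List.mem_of_mem_drop (h₄.subset (h5 ▸ List.getLast_mem hne)))
      omega
    subst hl₄
    rw [List.append_nil] at he'
    rw [← he'] at h₃
    exact hy (List.eq_of_mem_replicate (h₃.subset (by simp)))
  · apply h
    have := hxy.filter (· ≠ N)
    rw [filter_insertLetters hw] at this
    simpa [hx, hy] using this

/-- The copies of the maximal letter are adjacent, since a different letter between two of them
would be smaller than both. -/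
theorem exists_eq_insertLetters {N : ℕ} {w : List ℕ} (hw : ∀ x ∈ w, x ≤ N) (hN : N ∈ w)
    (h : IsStirlingWord w) : ∃ p ≤ (w.filter (· ≠ N)).length,
      w = insertLetters N (w.count N) (w.filter (· ≠ N)) p := by
  obtain ⟨A, B, rfl, hA⟩ := List.eq_append_cons_of_mem hN
  have hB := (List.takeWhile_append_dropWhile (p := fun z => decide (z = N)) (l := B)).symm
  set C := B.takeWhile fun z => decide (z = N) with hC
  set B' := B.dropWhile fun z => decide (z = N) with hB'
  have hCN : C = List.replicate C.length N := by
    rw [List.eq_replicate_iff]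
    refine ⟨rfl, fun z hz => ?_⟩
    simpa using List.mem_takeWhile_imp hz
  have hNB : N ∉ B' := by
    intro hmem
    rcases hB'' : B' with - | ⟨y, L⟩
    · simp [hB''] at hmem
    have hy : y ≠ N := by
      have := List.head_dropWhile_not (fun z => decide (z = N)) (l := B) (by rw [← hB', hB'']; simp)
      simp only [← hB', hB'', List.head_cons] at this
      simpa using this
    have hNL : N ∈ L := by
      rw [hB''] at hmem
      rcases List.mem_cons.1 hmem with h1 | h1
      · exact absurd h1.symm hy
      · exact h1
    have hsub : List.Sublist [N, y, N] (A ++ N :: B) := by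
      refine List.Sublist.trans ?_ (List.sublist_append_right _ _)
      refine List.Sublist.cons_cons _ ?_
      rw [hB, hB'']
      refine List.Sublist.trans ?_ (List.sublist_append_right _ _)
      exact List.Sublist.cons_cons _ (List.singleton_sublist.2 hNL)
    have h1 := h _ _ hsub
    have h2 := hw y (by rw [hB, hB'']; simp)
    omega
  have hf : ∀ l : List ℕ, N ∉ l → l.filter (· ≠ N) = l := by
    intro l hl
    rw [List.filter_eq_self]
    intro x hx
    simpa using fun e : x = N => hl (e ▸ hx)
  have hfilter : (A ++ N :: B).filter (· ≠ N) = A ++ B' := by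
    rw [hB, hCN, List.filter_append, List.filter_cons, List.filter_append, hf A hA, hf B' hNB]
    simp
  have hcount : (A ++ N :: B).count N = C.length + 1 := by
    rw [hB, hCN]
    simp [List.count_eq_zero_of_not_mem hA, List.count_eq_zero_of_not_mem hNB]
  refine ⟨A.length, by rw [hfilter]; simp, ?_⟩
  rw [hfilter, hcount, insertLetters, List.take_left, List.drop_left, List.replicate_succ,
    List.cons_append, ← hCN, ← hB]

theorem insertLetters_injective {N t : ℕ} (ht : 0 < t) {w w' : List ℕ} (hw : ∀ x ∈ w, x < N)
    (hw' : ∀ x ∈ w', x < N) {p p' : ℕ} (hp : p ≤ w.length) (hp' : p' ≤ w'.length)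
    (h : insertLetters N t w p = insertLetters N t w' p') : w = w' ∧ p = p' := by
  have h1 : w = w' := by
    rw [← filter_insertLetters (t := t) (p := p) hw, h, filter_insertLetters hw']
  subst h1
  refine ⟨rfl, ?_⟩
  -- The gap is recovered as the position of the first N; this needs at least one inserted letter.
  have key : ∀ q ≤ w.length, (insertLetters N t w q).idxOf N = q := by
    intro q hq
    obtain ⟨t, rfl⟩ : ∃ s, t = s + 1 := ⟨t - 1, by omega⟩
    rw [insertLetters, List.idxOf_append_of_notMem, List.replicate_succ, List.cons_append,
      List.idxOf_cons_self]
    · simp [hq]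
    · exact fun hmem => (hw N (List.mem_of_mem_take hmem)).false
  rw [← key p hp, h, key p' hp']

/-! ### Descents under insertion of the largest letter -/

/-- The number of descents of a word, by recursion. -/
def desc : List ℕ → ℕ
  | [] => 0
  | [_] => 1
  | x :: y :: l => (if y < x then 1 else 0) + desc (y :: l)

theorem card_descents (w : List ℕ) : (descents w).card = desc w := by
  have key : ∀ l : List ℕ, (descents l).card =
      ∑ i : Fin l.length, if (∀ h : i.val + 1 < l.length, l[i.val + 1] < l[i]) then 1 else 0 := by
    intro l
    rw [descents, Finset.card_filter]
  induction w with
  | nil => simp [key, desc]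
  | cons x l ih =>
    rcases l with - | ⟨y, l⟩
    · rw [key, desc]
      simp
    · rw [desc, ← ih, key, key]
      simp only [List.length_cons]
      rw [Fin.sum_univ_succ]
      congr 1
      · simp
      · simp

theorem desc_le_length (w : List ℕ) : desc w ≤ w.length := by
  rw [← card_descents]
  simpa using Finset.card_le_univ (descents w)

theorem desc_replicate_append {N t : ℕ} (ht : 0 < t) {w : List ℕ} (hw : ∀ x ∈ w, x < N) :
    desc (List.replicate t N ++ w) = 1 + desc w := by
  induction t with
  | zero => omega
  | succ t ih =>
    rcases t with - | t
    · rcases w with - | ⟨x, w⟩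
      · simp [desc]
      · simp [desc, hw x]
    · rw [List.replicate_succ, List.replicate_succ, List.cons_append, List.cons_append, desc,
        ← List.cons_append, ← List.replicate_succ, ih (by omega)]
      simp

/-- A block of N's placed right after a descent position (the end of the word included) replaces
that descent by its own; in any other gap, the front included, it adds one. With an arbitrary `f`,
the identity serves the two generating series as well as the bounds on the number of descents. -/
theorem sum_desc_insertLetters {M : Type*} [AddCommMonoid M] {N t : ℕ} (ht : 0 < t)
    {w : List ℕ} (hw : ∀ x ∈ w, x < N) (f : ℕ → M) :
    ∑ p ∈ Finset.range (w.length + 1), f (desc (insertLetters N t w p)) =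
      desc w • f (desc w) + (w.length + 1 - desc w) • f (desc w + 1) := by
  have h0 : ∀ {v : List ℕ}, (∀ x ∈ v, x < N) → desc (insertLetters N t v 0) = desc v + 1 := by
    intro v hv
    simp [insertLetters, desc_replicate_append ht hv, add_comm]
  induction w generalizing f with
  | nil => simp [h0 hw, desc]
  | cons x w ih =>
    have hw' : ∀ z ∈ w, z < N := fun z hz => hw z (List.mem_cons_of_mem _ hz)
    have hx : x < N := hw x (by simp)
    have hcons : ∀ p, insertLetters N t (x :: w) (p + 1) = x :: insertLetters N t w p := by
      intro p
      simp [insertLetters]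
    have hone : desc (x :: insertLetters N t w 0) = 1 + desc w := by
      obtain ⟨s, rfl⟩ : ∃ s, t = s + 1 := ⟨t - 1, by omega⟩
      have h1 := h0 hw'
      simp only [insertLetters, List.take_zero, List.nil_append, List.drop_zero,
        List.replicate_succ, List.cons_append] at h1 ⊢
      rw [desc, h1, if_neg (by omega)]
      omega
    rw [List.length_cons, Finset.sum_range_succ', h0 hw]
    simp only [hcons]
    rcases w with - | ⟨y, w⟩
    · simp [hone, desc]
    · set c := if y < x then 1 else 0 with hc
      have hrest : ∀ p, desc (x :: insertLetters N t (y :: w) (p + 1)) =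
          c + desc (insertLetters N t (y :: w) (p + 1)) := by
        intro p
        simp [insertLetters, desc, hc]
      -- The contribution `c` of the first letter is absorbed into the test function, which is why
      -- `f` is generalized.
      have ih' := ih hw' (fun d => f (c + d))
      have hd : desc (x :: y :: w) = c + desc (y :: w) := rfl
      have hle := desc_le_length (y :: w)
      rw [Finset.sum_range_succ', h0 hw'] at ih'
      rw [Finset.sum_range_succ', hone, hd]
      simp only [hrest]
      set d := desc (y :: w)
      set L := (y :: w).length
      -- Insertion right after `x` always gives `1 + d` descents. This preserves the number if `y <
      -- x` and raises it otherwise, so the gap is counted in the first or in the second term.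
      by_cases hyx : y < x
      · have hc1 : c = 1 := by simp [hc, hyx]
        simp only [hc1] at ih' ⊢
        have e1 : 1 + d + 1 = 1 + (d + 1) := by ring
        have e2 : L + 1 + 1 - (1 + d) = L + 1 - d := by omega
        rw [e1, e2, add_right_comm, ih', add_comm 1 d, add_smul, one_smul]
        abel
      · have hc0 : c = 0 := by simp [hc, hyx]
        simp only [hc0, zero_add] at ih' ⊢
        have e2 : L + 1 + 1 - d = (L + 1 - d) + 1 := by omega
        rw [add_comm 1 d, ih', e2, add_smul, one_smul]
        abel

/-- The Stirling permutations of type `k`. -/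
noncomputable def stirlingPerms (k : List ℕ) : Finset (List ℕ) :=
  open Classical in (multisetOfType k).lists.toFinset.filter IsStirlingWord

theorem mem_stirlingPerms {k w : List ℕ} :
    w ∈ stirlingPerms k ↔ (w : Multiset ℕ) = multisetOfType k ∧ IsStirlingWord w := by
  classical
  rw [stirlingPerms, Finset.mem_filter, Multiset.mem_toFinset, Multiset.mem_lists_iff]
  exact and_congr_left fun _ => eq_comm

theorem mem_stirlingPerms_iff {k w : List ℕ} : w ∈ stirlingPerms k ↔ IsStirlingPerm k w := by
  rw [mem_stirlingPerms, isStirlingWord_iff, IsStirlingPerm]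

theorem eulerian_eq (k : List ℕ) (i : ℕ) :
    eulerian k i = ((stirlingPerms k).filter fun w => desc w = i).card := by
  rw [eulerian, ← Set.ncard_coe_finset]
  congr 1
  ext w
  simp [mem_stirlingPerms_iff, card_descents]

theorem length_of_mem_stirlingPerms {k w : List ℕ} (h : w ∈ stirlingPerms k) :
    w.length = k.sum := by
  rw [← card_multisetOfType, ← (mem_stirlingPerms.1 h).1, Multiset.coe_card]

theorem lt_of_mem_stirlingPerms {k w : List ℕ} (h : w ∈ stirlingPerms k) :
    ∀ x ∈ w, x < k.length + 1 := by
  intro x hx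
  rw [Nat.lt_succ_iff]
  apply le_length_of_mem_multisetOfType
  rw [← (mem_stirlingPerms.1 h).1]
  exact hx

/-- Pairs of a shorter permutation and one of its K+1 gaps correspond bijectively to the longer
permutations; the inverse deletes the largest letter. -/
theorem sum_stirlingPerms_append {M : Type*} [AddCommMonoid M] (k : List ℕ) {t : ℕ} (ht : 0 < t)
    (f : ℕ → M) :
    ∑ w ∈ stirlingPerms (k ++ [t]), f (desc w) =
      ∑ w ∈ stirlingPerms k,
        (desc w • f (desc w) + (k.sum + 1 - desc w) • f (desc w + 1)) := by
  set N := k.length + 1 with hN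
  have hstep : ∀ w ∈ stirlingPerms k,
      desc w • f (desc w) + (k.sum + 1 - desc w) • f (desc w + 1) =
      ∑ p ∈ Finset.range (k.sum + 1), f (desc (insertLetters N t w p)) := by
    intro w hw
    rw [← length_of_mem_stirlingPerms hw,
      sum_desc_insertLetters ht (lt_of_mem_stirlingPerms hw) f]
  rw [Finset.sum_congr rfl hstep, ← Finset.sum_product']
  symm
  refine Finset.sum_nbij (fun q => insertLetters N t q.1 q.2) ?_ ?_ ?_ ?_
  · rintro ⟨w, p⟩ hq
    rw [Finset.mem_product] at hq
    have hw := hq.1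
    simp only at hw ⊢
    rw [mem_stirlingPerms, multisetOfType_append]
    refine ⟨?_, isStirlingWord_insertLetters (lt_of_mem_stirlingPerms hw)
      (mem_stirlingPerms.1 hw).2⟩
    rw [← (mem_stirlingPerms.1 hw).1, insertLetters, ← Multiset.coe_add, ← Multiset.coe_add,
      ← Multiset.coe_replicate, add_left_comm, Multiset.coe_add, List.take_append_drop, add_comm]
  · rintro ⟨w, p⟩ hq ⟨w', p'⟩ hq' he
    simp only [Finset.coe_product, Set.mem_prod, Finset.mem_coe, Finset.mem_range] at hq hq'
    have := insertLetters_injective ht (lt_of_mem_stirlingPerms hq.1)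
      (lt_of_mem_stirlingPerms hq'.1)
      (by rw [length_of_mem_stirlingPerms hq.1]; omega)
      (by rw [length_of_mem_stirlingPerms hq'.1]; omega) he
    exact Prod.ext this.1 this.2
  · intro w' hw'
    rw [Finset.mem_coe, mem_stirlingPerms, multisetOfType_append] at hw'
    obtain ⟨hm, hs⟩ := hw'
    have hNk : N ∉ multisetOfType k := fun h => by
      have := le_length_of_mem_multisetOfType h
      omega
    have hc : w'.count N = t := by
      rw [← Multiset.coe_count, hm, Multiset.count_add, Multiset.count_eq_zero_of_notMem hNk,
        Multiset.count_replicate_self, zero_add]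
    obtain ⟨p, hp, he⟩ := exists_eq_insertLetters (N := N) (w := w') (fun x hx => by
      rw [← Multiset.mem_coe, hm, Multiset.mem_add] at hx
      rcases hx with hx | hx
      · have := le_length_of_mem_multisetOfType hx
        omega
      · exact (Multiset.eq_of_mem_replicate hx).le)
      (List.count_pos_iff.1 (by omega)) hs
    have hw : w'.filter (· ≠ N) ∈ stirlingPerms k := by
      rw [mem_stirlingPerms]
      refine ⟨?_, fun x y hxy => hs x y (hxy.trans List.filter_sublist)⟩
      rw [← Multiset.filter_coe, hm, Multiset.filter_add, Multiset.filter_eq_self.2,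
        Multiset.filter_eq_nil.2, add_zero]
      · intro x hx
        simpa using Multiset.eq_of_mem_replicate hx
      · intro x hx e
        exact hNk (e ▸ hx)
    refine ⟨(w'.filter (· ≠ N), p), ?_, ?_⟩
    · rw [Finset.mem_coe, Finset.mem_product, Finset.mem_range,
        ← length_of_mem_stirlingPerms hw]
      exact ⟨hw, by simp only; omega⟩
    · simp only
      rw [← hc]
      exact he.symm
  · intro q _
    rfl

theorem stirlingPerms_nil : stirlingPerms [] = {[]} := by
  ext w
  rw [mem_stirlingPerms, Finset.mem_singleton]
  constructor
  · rintro ⟨h, -⟩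
    simpa [multisetOfType] using h
  · rintro rfl
    exact ⟨by simp [multisetOfType], fun x y h => by simp at h⟩

/-! ### Sums over monotone sequences -/

/-- Removing the last index makes it the upper bound of the remaining ones. The sums thus obey the
recursion that the series coefficients satisfy when a block of `k` is appended. -/
theorem snoc_mem_weakSeqs {ℓ m : ℕ} (s : Fin ℓ → ℕ) (i : ℕ) :
    (Fin.snoc s i : Fin (ℓ + 1) → ℕ) ∈ weakSeqs (ℓ + 1) m ↔
      i ∈ Finset.Icc 1 m ∧ s ∈ weakSeqs ℓ i := by
  simp only [weakSeqs, Finset.mem_filter, Fintype.mem_piFinset, Fin.forall_fin_succ',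
    Fin.snoc_castSucc, Fin.snoc_last, Finset.mem_Icc, Fin.castSucc_lt_castSucc_iff,
    Fin.castSucc_lt_last, lt_irrefl, (Fin.castSucc_lt_last _).not_gt]
  constructor
  · rintro ⟨⟨h1, h2⟩, h3, h4⟩
    exact ⟨h2, fun p => ⟨(h1 p).1, (h3 p).2 trivial⟩, fun p q => (h3 p).1 q⟩
  · rintro ⟨h1, h2, h3⟩
    exact ⟨⟨fun p => ⟨(h2 p).1, (h2 p).2.trans h1.2⟩, h1⟩,
      fun p => ⟨h3 p, fun _ => (h2 p).2⟩, fun _ h => h.elim, fun h => h.elim⟩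

theorem snoc_mem_strictSeqs {ℓ m : ℕ} (s : Fin ℓ → ℕ) (i : ℕ) :
    (Fin.snoc s i : Fin (ℓ + 1) → ℕ) ∈ strictSeqs (ℓ + 1) m ↔
      i ∈ Finset.Ico 1 m ∧ s ∈ strictSeqs ℓ i := by
  simp only [strictSeqs, Finset.mem_filter, Fintype.mem_piFinset, Fin.forall_fin_succ',
    Fin.snoc_castSucc, Fin.snoc_last, Finset.mem_Ico, Fin.castSucc_lt_castSucc_iff,
    Fin.castSucc_lt_last, lt_irrefl, (Fin.castSucc_lt_last _).not_gt]
  constructor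
  · rintro ⟨⟨h1, h2⟩, h3, h4⟩
    exact ⟨h2, fun p => ⟨(h1 p).1, (h3 p).2 trivial⟩, fun p q => (h3 p).1 q⟩
  · rintro ⟨h1, h2, h3⟩
    exact ⟨⟨fun p => ⟨(h2 p).1, (h2 p).2.trans h1.2⟩, h1⟩,
      fun p => ⟨h3 p, fun _ => (h2 p).2⟩, fun _ h => h.elim, fun h => h.elim⟩

theorem sum_weakSeqs_succ {M : Type*} [AddCommMonoid M] (ℓ m : ℕ) (f : (Fin (ℓ + 1) → ℕ) → M) :
    ∑ s ∈ weakSeqs (ℓ + 1) m, f s =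
      ∑ i ∈ Finset.Icc 1 m, ∑ s ∈ weakSeqs ℓ i, f (Fin.snoc s i) := by
  rw [Finset.sum_sigma']
  refine Finset.sum_bij' (fun s _ => ⟨s (Fin.last ℓ), Fin.init s⟩)
    (fun p _ => Fin.snoc p.2 p.1) ?_ ?_ ?_ ?_ ?_
  · intro s hs
    rw [← Fin.snoc_init_self s, snoc_mem_weakSeqs] at hs
    simpa using hs
  · rintro ⟨i, s⟩ hs
    rw [snoc_mem_weakSeqs]
    simpa using hs
  · intro s _
    exact Fin.snoc_init_self s
  · rintro ⟨i, s⟩ _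
    simp
  · intro s _
    rw [Fin.snoc_init_self]

theorem sum_strictSeqs_succ {M : Type*} [AddCommMonoid M] (ℓ m : ℕ) (f : (Fin (ℓ + 1) → ℕ) → M) :
    ∑ s ∈ strictSeqs (ℓ + 1) m, f s =
      ∑ i ∈ Finset.Ico 1 m, ∑ s ∈ strictSeqs ℓ i, f (Fin.snoc s i) := by
  rw [Finset.sum_sigma']
  refine Finset.sum_bij' (fun s _ => ⟨s (Fin.last ℓ), Fin.init s⟩)
    (fun p _ => Fin.snoc p.2 p.1) ?_ ?_ ?_ ?_ ?_
  · intro s hs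
    rw [← Fin.snoc_init_self s, snoc_mem_strictSeqs] at hs
    simpa using hs
  · rintro ⟨i, s⟩ hs
    rw [snoc_mem_strictSeqs]
    simpa using hs
  · intro s _
    exact Fin.snoc_init_self s
  · rintro ⟨i, s⟩ _
    simp
  · intro s _
    rw [Fin.snoc_init_self]

/-- The product attached to a sequence in the explicit formulas, for a general last factor. -/
def seqWeight (c : ℕ → ℕ → ℕ → ℕ) {ℓ : ℕ} (a t : Fin ℓ → ℕ) (m : ℕ) (i : Fin ℓ → ℕ) : ℕ :=
  (∏ j, i j ^ a j) * ∏ j : Fin ℓ, c (t j) (i j) (prolong i m j.succ)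

theorem seqWeight_snoc (c : ℕ → ℕ → ℕ → ℕ) {ℓ : ℕ} (a t : Fin (ℓ + 1) → ℕ) (m i : ℕ)
    (s : Fin ℓ → ℕ) :
    seqWeight c a t m (Fin.snoc s i : Fin (ℓ + 1) → ℕ) =
      i ^ a (Fin.last ℓ) * seqWeight c (fun j => a j.castSucc) (fun j => t j.castSucc) i s *
        c (t (Fin.last ℓ)) i m := by
  have h : ∀ j : Fin ℓ, prolong (Fin.snoc s i : Fin (ℓ + 1) → ℕ) m j.castSucc.succ =
      prolong s i j.succ := by
    intro j
    rw [Fin.succ_castSucc, prolong, Fin.snoc_castSucc, prolong]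
  rw [seqWeight, Fin.prod_univ_castSucc, Fin.prod_univ_castSucc, seqWeight]
  simp only [Fin.snoc_castSucc, Fin.snoc_last, h]
  have hlast : prolong (Fin.snoc s i : Fin (ℓ + 1) → ℕ) m (Fin.last ℓ).succ = m := by
    rw [Fin.succ_last, prolong, Fin.snoc_last]
  rw [hlast]
  ring

/-! ### The generating functions -/

open PowerSeries

theorem one_sub_X_mul_inv : (1 - X : ℚ⟦X⟧) * (1 - X)⁻¹ = 1 :=
  PowerSeries.mul_inv_cancel _ (by simp)

theorem inv_one_sub_X_pow (n : ℕ) : (((1 - X) ^ n)⁻¹ : ℚ⟦X⟧) = ((1 - X)⁻¹) ^ n := by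
  symm
  rw [PowerSeries.eq_inv_iff_mul_eq_one (by simp), ← mul_pow, mul_comm, one_sub_X_mul_inv, one_pow]

theorem coeff_inv_one_sub_X_pow_succ (s n : ℕ) :
    coeff n (((1 - X)⁻¹ : ℚ⟦X⟧) ^ (s + 1)) = (s + n).choose s := by
  have h : (mk fun n => ((s + n).choose s : ℚ)) = (((1 - X)⁻¹ : ℚ⟦X⟧) ^ (s + 1)) := by
    rw [← inv_one_sub_X_pow, PowerSeries.eq_inv_iff_mul_eq_one (by simp)]
    exact mk_add_choose_mul_one_sub_pow_eq_one ℚ s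
  rw [← h, coeff_mk]

theorem coeff_X_mul_derivative (F : ℚ⟦X⟧) (n : ℕ) :
    coeff n (X * d⁄dX ℚ F) = n * coeff n F := by
  rcases n with - | n
  · simp
  · rw [coeff_succ_X_mul, coeff_derivative]
    push_cast
    ring

/-- The coefficients `d` and `e` are the two gap counts of the insertion step. Stating them
symmetrically allows the use with exchanged roles for the reversed numerator. -/
theorem X_mul_derivative_X_pow_mul (d e : ℕ) (K : ℕ) (h : d + e = K + 1) :
    X * d⁄dX ℚ (X ^ d * (1 - X)⁻¹ ^ (K + 1)) =
      (d • X ^ d + e • X ^ (d + 1)) * (1 - X : ℚ⟦X⟧)⁻¹ ^ (K + 2) := by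
  have hu := one_sub_X_mul_inv
  have hDu : d⁄dX ℚ ((1 - X : ℚ⟦X⟧)⁻¹) = (1 - X : ℚ⟦X⟧)⁻¹ ^ 2 := by
    rw [derivative_inv']
    simp
  set u : ℚ⟦X⟧ := (1 - X)⁻¹
  have hXd : X * d⁄dX ℚ (X ^ d : ℚ⟦X⟧) = d • X ^ d := by
    rcases d with - | d
    · simp
    · rw [derivative_pow, derivative_X]
      simp only [Nat.add_sub_cancel, nsmul_eq_mul]
      ring
  have hUd : d⁄dX ℚ (u ^ (K + 1)) = (K + 1) * u ^ (K + 2) := by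
    rw [derivative_pow, hDu]
    simp only [Nat.add_sub_cancel]
    push_cast
    ring
  have he : (e : ℚ⟦X⟧) = K + 1 - d := by
    have : ((d + e : ℕ) : ℚ⟦X⟧) = (K + 1 : ℕ) := by rw [h]
    push_cast at this
    linear_combination this
  have hX : X * d⁄dX ℚ (X ^ d * u ^ (K + 1)) =
      (X * d⁄dX ℚ (X ^ d : ℚ⟦X⟧)) * u ^ (K + 1) + X ^ (d + 1) * d⁄dX ℚ (u ^ (K + 1)) := by
    rw [Derivation.leibniz]
    simp only [smul_eq_mul]
    ring
  rw [hX, hXd, hUd, nsmul_eq_mul, nsmul_eq_mul, he]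
  -- The only discrepancy is that `d * X ^ d` carries `u ^ (K + 1)` instead of `u ^ (K + 2)`; it is
  -- removed by `(1 - X) * u = 1`.
  linear_combination (-(d : ℚ⟦X⟧) * X ^ d * u ^ (K + 1)) * hu

/-! ### Recursion for the two generating series -/

/-- The series `∑ x^{des w} / (1-x)^{K+1}`. -/
noncomputable def descSeries (k : List ℕ) : ℚ⟦X⟧ :=
  ∑ w ∈ stirlingPerms k, X ^ desc w * (1 - X)⁻¹ ^ (k.sum + 1)

/-- The series `∑ x^{K+1-des w} / (1-x)^{K+1}`. -/
noncomputable def codescSeries (k : List ℕ) : ℚ⟦X⟧ :=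
  ∑ w ∈ stirlingPerms k, X ^ (k.sum + 1 - desc w) * (1 - X)⁻¹ ^ (k.sum + 1)

theorem desc_le_of_mem_stirlingPerms {k w : List ℕ} (h : w ∈ stirlingPerms k) :
    desc w ≤ k.sum := by
  rw [← length_of_mem_stirlingPerms h]
  exact desc_le_length w

/-- The exponent of the denominator grows by `t`. The Euler operator accounts for one of these
factors and leaves `t - 1`. -/
theorem descSeries_append (k : List ℕ) {t : ℕ} (ht : 0 < t) :
    descSeries (k ++ [t]) = X * d⁄dX ℚ (descSeries k) * (1 - X)⁻¹ ^ (t - 1) := by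
  obtain ⟨t, rfl⟩ : ∃ s, t = s + 1 := ⟨t - 1, by omega⟩
  rw [descSeries, sum_stirlingPerms_append k ht
    (fun d => (X : ℚ⟦X⟧) ^ d * (1 - X)⁻¹ ^ ((k ++ [t + 1]).sum + 1)), descSeries, map_sum,
    Finset.mul_sum, Finset.sum_mul]
  refine Finset.sum_congr rfl fun w hw => ?_
  have hd := desc_le_of_mem_stirlingPerms hw
  rw [X_mul_derivative_X_pow_mul (desc w) (k.sum + 1 - desc w) k.sum (by omega)]
  have e1 : (k ++ [t + 1]).sum + 1 = (k.sum + 2) + t := by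
    simp
    ring
  rw [e1, Nat.add_sub_cancel, pow_add _ (k.sum + 2)]
  simp only [nsmul_eq_mul]
  ring

/-- In terms of K+1-des the two kinds of gaps exchange roles, and the growth of K by `t` contributes
an additional `X ^ (t - 1)`. -/
theorem codescSeries_append (k : List ℕ) {t : ℕ} (ht : 0 < t) :
    codescSeries (k ++ [t]) =
      X * d⁄dX ℚ (codescSeries k) * (X ^ (t - 1) * (1 - X)⁻¹ ^ (t - 1)) := by
  obtain ⟨t, rfl⟩ : ∃ s, t = s + 1 := ⟨t - 1, by omega⟩
  rw [codescSeries, sum_stirlingPerms_append k ht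
    (fun d => (X : ℚ⟦X⟧) ^ ((k ++ [t + 1]).sum + 1 - d) * (1 - X)⁻¹ ^ ((k ++ [t + 1]).sum + 1)),
    codescSeries, map_sum, Finset.mul_sum, Finset.sum_mul]
  refine Finset.sum_congr rfl fun w hw => ?_
  have hd := desc_le_of_mem_stirlingPerms hw
  rw [X_mul_derivative_X_pow_mul (k.sum + 1 - desc w) (desc w) k.sum (by omega)]
  have e1 : (k ++ [t + 1]).sum + 1 = (k.sum + 2) + t := by
    simp
    ring
  have e2 : k.sum + 2 + t - desc w = (k.sum + 1 - desc w + 1) + t := by omega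
  have e3 : k.sum + 2 + t - (desc w + 1) = (k.sum + 1 - desc w) + t := by omega
  rw [e1, e2, e3, Nat.add_sub_cancel, pow_add _ (k.sum + 2)]
  simp only [nsmul_eq_mul]
  ring

theorem coeff_descSeries_append_replicate (k : List ℕ) (r n : ℕ) :
    coeff n (descSeries (k ++ List.replicate r 1)) = n ^ r * coeff n (descSeries k) := by
  induction r with
  | zero => simp
  | succ r ih =>
    rw [List.replicate_succ', ← List.append_assoc, descSeries_append _ one_pos, Nat.sub_self,
      pow_zero, mul_one, coeff_X_mul_derivative, ih]
    ring

theorem coeff_codescSeries_append_replicate (k : List ℕ) (r n : ℕ) :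
    coeff n (codescSeries (k ++ List.replicate r 1)) = n ^ r * coeff n (codescSeries k) := by
  induction r with
  | zero => simp
  | succ r ih =>
    rw [List.replicate_succ', ← List.append_assoc, codescSeries_append _ one_pos, Nat.sub_self,
      pow_zero, pow_zero, mul_one, mul_one, coeff_X_mul_derivative, ih]
    ring

/-- The `a` entries apply the Euler operator `a` times, whence `i ^ a`; the final factor `(1 - X)⁻¹
^ (t - 1)` is the convolution kernel. The term i = 0 is killed by the Euler operator. -/
theorem coeff_descSeries_append (k : List ℕ) {a t : ℕ} (ha : 0 < a) (ht : 1 < t) (m : ℕ) :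
    coeff m (descSeries (k ++ (List.replicate (a - 1) 1 ++ [t]))) =
      ∑ i ∈ Finset.Icc 1 m, (i : ℚ) ^ a * coeff i (descSeries k) *
        ((t + m - i - 2).choose (m - i) : ℕ) := by
  obtain ⟨a, rfl⟩ : ∃ s, a = s + 1 := ⟨a - 1, by omega⟩
  obtain ⟨t, rfl⟩ : ∃ s, t = s + 2 := ⟨t - 2, by omega⟩
  rw [← List.append_assoc, descSeries_append _ (by omega), coeff_mul,
    Finset.Nat.sum_antidiagonal_eq_sum_range_succ_mk, Finset.range_eq_Ico,
    Finset.sum_eq_sum_Ico_succ_bot (by omega), coeff_X_mul_derivative]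
  simp only [Nat.cast_zero, zero_mul, zero_add]
  refine Finset.sum_congr (by ext; simp) fun i hi => ?_
  rw [Finset.mem_Icc] at hi
  rw [coeff_X_mul_derivative, Nat.add_sub_cancel, coeff_descSeries_append_replicate,
    show t + 2 - 1 = t + 1 by omega, coeff_inv_one_sub_X_pow_succ,
    show t + 2 + m - i - 2 = t + (m - i) by omega, Nat.choose_symm_add]
  ring

/-- Here the kernel `(X / (1 - X)) ^ (t - 1)` has no constant term, so the index i = m drops out and
the inequalities become strict. -/
theorem coeff_codescSeries_append (k : List ℕ) {a t : ℕ} (ha : 0 < a) (ht : 1 < t) (m : ℕ) :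
    coeff m (codescSeries (k ++ (List.replicate (a - 1) 1 ++ [t]))) =
      ∑ i ∈ Finset.Ico 1 m, (i : ℚ) ^ a * coeff i (codescSeries k) *
        ((m - i - 1).choose (t - 2) : ℕ) := by
  obtain ⟨a, rfl⟩ : ∃ s, a = s + 1 := ⟨a - 1, by omega⟩
  obtain ⟨t, rfl⟩ : ∃ s, t = s + 2 := ⟨t - 2, by omega⟩
  -- The case n = 0 is separate because of truncated subtraction: `(0 - 1).choose t` would be 1 for
  -- t = 0.
  have hcoeff : ∀ n, coeff n ((X : ℚ⟦X⟧) ^ (t + 1) * (1 - X)⁻¹ ^ (t + 1)) =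
      if n = 0 then 0 else ((n - 1).choose t : ℚ) := by
    intro n
    rw [coeff_X_pow_mul']
    split_ifs with h1 h2 h2
    · omega
    · rw [coeff_inv_one_sub_X_pow_succ, show t + (n - (t + 1)) = n - 1 by omega]
    · rfl
    · rw [Nat.choose_eq_zero_of_lt (by omega), Nat.cast_zero]
  rw [← List.append_assoc, codescSeries_append _ (by omega), coeff_mul,
    Finset.Nat.sum_antidiagonal_eq_sum_range_succ_mk, Finset.sum_range_succ,
    show t + 2 - 1 = t + 1 by omega]
  simp only [hcoeff, coeff_X_mul_derivative, coeff_codescSeries_append_replicate, Nat.sub_self,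
    if_true, mul_zero, add_zero, Nat.add_sub_cancel]
  rcases Nat.eq_zero_or_pos m with rfl | hm
  · simp
  rw [Finset.range_eq_Ico, Finset.sum_eq_sum_Ico_succ_bot hm]
  simp only [Nat.cast_zero, zero_mul, zero_add]
  refine Finset.sum_congr rfl fun i hi => ?_
  rw [Finset.mem_Ico] at hi
  rw [if_neg (by omega)]
  ring

theorem coeff_descSeries_nil (m : ℕ) : coeff m (descSeries []) = 1 := by
  have := coeff_inv_one_sub_X_pow_succ 0 m
  simpa [descSeries, stirlingPerms_nil, desc] using this

/-- For the empty type the series is X/(1-X), whose constant term vanishes although the empty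
sequence has weight 1. This is the origin of the condition `0 < m ∨ 0 < ℓ` in
`coeff_codescSeries_listOfWeight`. -/
theorem coeff_codescSeries_nil {m : ℕ} (hm : 0 < m) : coeff m (codescSeries []) = 1 := by
  obtain ⟨m, rfl⟩ : ∃ s, m = s + 1 := ⟨m - 1, by omega⟩
  have := coeff_inv_one_sub_X_pow_succ 0 m
  simpa [codescSeries, stirlingPerms_nil, desc, coeff_succ_X_mul] using this

/-- The list of weight `(a; t; 0)`. -/
def listOfWeight {ℓ : ℕ} (a t : Fin ℓ → ℕ) : List ℕ :=
  (List.ofFn fun i => List.replicate (a i - 1) 1 ++ [t i]).flatten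

theorem listOfWeight_succ {ℓ : ℕ} (a t : Fin (ℓ + 1) → ℕ) :
    listOfWeight a t = listOfWeight (fun j => a j.castSucc) (fun j => t j.castSucc) ++
      (List.replicate (a (Fin.last ℓ) - 1) 1 ++ [t (Fin.last ℓ)]) := by
  rw [listOfWeight, List.ofFn_succ', List.concat_eq_append, List.flatten_append, listOfWeight]
  simp

theorem coeff_descSeries_listOfWeight {ℓ : ℕ} (a t : Fin ℓ → ℕ) (ha : ∀ j, 0 < a j)
    (ht : ∀ j, 1 < t j) (m : ℕ) :
    coeff m (descSeries (listOfWeight a t)) =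
      (∑ i ∈ weakSeqs ℓ m, seqWeight (fun t i i' => (t + i' - i - 2).choose (i' - i)) a t m i :
        ℕ) := by
  induction ℓ generalizing m with
  | zero =>
    simp [listOfWeight, coeff_descSeries_nil, weakSeqs, seqWeight]
  | succ ℓ ih =>
    rw [listOfWeight_succ, coeff_descSeries_append _ (ha _) (ht _), sum_weakSeqs_succ]
    push_cast
    refine Finset.sum_congr rfl fun i _ => ?_
    rw [ih _ _ (fun j => ha _) (fun j => ht _)]
    simp only [seqWeight_snoc]
    push_cast
    rw [Finset.mul_sum, Finset.sum_mul]

theorem coeff_codescSeries_listOfWeight {ℓ : ℕ} (a t : Fin ℓ → ℕ) (ha : ∀ j, 0 < a j)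
    (ht : ∀ j, 1 < t j) (m : ℕ) (hm : 0 < m ∨ 0 < ℓ) :
    coeff m (codescSeries (listOfWeight a t)) =
      (∑ i ∈ strictSeqs ℓ m, seqWeight (fun t i i' => (i' - i - 1).choose (t - 2)) a t m i :
        ℕ) := by
  induction ℓ generalizing m with
  | zero =>
    simp [listOfWeight, coeff_codescSeries_nil (by omega : 0 < m), strictSeqs, seqWeight]
  | succ ℓ ih =>
    rw [listOfWeight_succ, coeff_codescSeries_append _ (ha _) (ht _), sum_strictSeqs_succ]
    push_cast
    refine Finset.sum_congr rfl fun i hi => ?_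
    rw [Finset.mem_Ico] at hi
    rw [ih _ _ (fun j => ha _) (fun j => ht _) i (Or.inl hi.1)]
    simp only [seqWeight_snoc]
    push_cast
    rw [Finset.mul_sum, Finset.sum_mul]

/-- The insertion identity is applied to the indicator of the excluded numbers of descents: the sum
vanishes, hence so does each term. -/
theorem desc_mem_Icc_of_mem_stirlingPerms {k : List ℕ} (hk : ∀ x ∈ k, 0 < x) :
    ∀ w ∈ stirlingPerms k, desc w ≤ k.length ∧ (k ≠ [] → 1 ≤ desc w) := by
  induction k using List.reverseRecOn with
  | nil => simp [stirlingPerms_nil, desc]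
  | append_singleton k t ih =>
    have ih := ih fun x hx => hk x (by simp [hx])
    have hs := sum_stirlingPerms_append k (hk t (by simp))
      (fun d => if d ≤ k.length + 1 ∧ 1 ≤ d then 0 else 1)
    rw [Finset.sum_eq_zero (s := stirlingPerms k)] at hs
    · intro w hw
      have := Finset.sum_eq_zero_iff.1 hs w hw
      simp only [ite_eq_left_iff, one_ne_zero, imp_false, not_not] at this
      simpa using this
    · intro w hw
      have := (ih w hw).1
      rw [if_pos (by omega : desc w + 1 ≤ k.length + 1 ∧ 1 ≤ desc w + 1), smul_zero, add_zero]
      -- A word without descents has no gap preserving that number, so the excluded value 0 gets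
      -- weight zero.
      rcases Nat.eq_zero_or_pos (desc w) with h0 | h0
      · rw [h0, zero_smul]
      · rw [if_pos ⟨by omega, h0⟩, smul_zero]

/-- Grouping words by descents loses nothing, as every number of descents lies between 1 and the
length of `k`. -/
theorem G_eq_descSeries {k : List ℕ} (hk : ∀ x ∈ k, 0 < x) (hne : k ≠ []) :
    G k = descSeries k := by
  rw [G, descSeries, inv_one_sub_X_pow, ← Finset.sum_mul]
  congr 1
  rw [← Finset.sum_fiberwise_of_maps_to (t := Finset.Icc 1 k.length) (g := desc)]
  · refine Finset.sum_congr rfl fun i _ => ?_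
    rw [eulerian_eq, Finset.sum_congr rfl (g := fun _ => X ^ i), Finset.sum_const, nsmul_eq_mul]
    intro w hw
    rw [(Finset.mem_filter.1 hw).2]
  · intro w hw
    have := desc_mem_Icc_of_mem_stirlingPerms hk w hw
    exact Finset.mem_Icc.2 ⟨this.2 hne, this.1⟩

theorem g_eq_codescSeries {k : List ℕ} (hk : ∀ x ∈ k, 0 < x) (hne : k ≠ []) :
    g k = codescSeries k := by
  have hlen : k.length ≤ k.sum := List.length_le_sum_of_one_le k hk
  have hd : ∀ w ∈ stirlingPerms k, desc w ≤ k.length ∧ 1 ≤ desc w := fun w hw =>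
    ⟨(desc_mem_Icc_of_mem_stirlingPerms hk w hw).1,
      (desc_mem_Icc_of_mem_stirlingPerms hk w hw).2 hne⟩
  rw [g, codescSeries, inv_one_sub_X_pow, ← Finset.sum_mul]
  congr 1
  rw [← Finset.sum_fiberwise_of_maps_to (t := Finset.Icc (k.sum - k.length + 1) k.sum)
    (g := fun w => k.sum + 1 - desc w)]
  · refine Finset.sum_congr rfl fun i hi => ?_
    rw [Finset.mem_Icc] at hi
    rw [eulerian_eq, Finset.sum_congr rfl (g := fun _ => X ^ i), Finset.sum_const, nsmul_eq_mul]
    · congr 3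
      refine Finset.filter_congr fun w hw => ?_
      have := hd w hw
      omega
    · intro w hw
      rw [(Finset.mem_filter.1 hw).2]
  · intro w hw
    have := hd w hw
    rw [Finset.mem_Icc]
    omega

theorem pos_of_mem_listOfWeight {ℓ : ℕ} {a t : Fin ℓ → ℕ} (ht : ∀ j, 1 < t j) :
    ∀ x ∈ listOfWeight a t, 0 < x := by
  intro x hx
  simp only [listOfWeight, List.mem_flatten, List.mem_ofFn] at hx
  obtain ⟨_, ⟨j, rfl⟩, hx⟩ := hx
  rw [List.mem_append, List.mem_replicate, List.mem_singleton] at hx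
  have := ht j
  omega

theorem listOfWeight_ne_nil {ℓ : ℕ} (hℓ : 0 < ℓ) (a t : Fin ℓ → ℕ) : listOfWeight a t ≠ [] := by
  obtain ⟨ℓ, rfl⟩ : ∃ s, ℓ = s + 1 := ⟨ℓ - 1, by omega⟩
  rw [listOfWeight_succ]
  simp

theorem B_eq_sum {ℓ : ℕ} (hℓ : 0 < ℓ) {a t : Fin ℓ → ℕ} (ha : ∀ j, 0 < a j)
    (ht : ∀ j, 1 < t j) (m : ℕ) : B (listOfWeight a t) m =
      (∑ i ∈ weakSeqs ℓ m, seqWeight (fun t i i' => (t + i' - i - 2).choose (i' - i)) a t m i :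
        ℕ) := by
  rw [B, G_eq_descSeries (pos_of_mem_listOfWeight ht) (listOfWeight_ne_nil hℓ a t),
    coeff_descSeries_listOfWeight a t ha ht]

theorem b_eq_sum {ℓ : ℕ} (hℓ : 0 < ℓ) {a t : Fin ℓ → ℕ} (ha : ∀ j, 0 < a j)
    (ht : ∀ j, 1 < t j) (m : ℕ) : b (listOfWeight a t) m =
      (∑ i ∈ strictSeqs ℓ m, seqWeight (fun t i i' => (i' - i - 1).choose (t - 2)) a t m i :
        ℕ) := by
  rw [b, g_eq_codescSeries (pos_of_mem_listOfWeight ht) (listOfWeight_ne_nil hℓ a t),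
    coeff_codescSeries_listOfWeight a t ha ht m (Or.inr hℓ)]

/-! ### Permutations by the numbers of smaller letters on the left -/

/-- The letters smaller than `v` which stand to the left of `v` in the permutation `σ`. -/
def smallerLeft {n : ℕ} (σ : Equiv.Perm (Fin n)) (v : Fin n) : Finset (Fin n) :=
  {u | u < v ∧ σ.symm u < σ.symm v}

theorem mem_smallerLeft {n : ℕ} {σ : Equiv.Perm (Fin n)} {u v : Fin n} :
    u ∈ smallerLeft σ v ↔ u < v ∧ σ.symm u < σ.symm v := by
  simp [smallerLeft]

theorem smallerLeft_subset {n : ℕ} (σ : Equiv.Perm (Fin n)) (v : Fin n) :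
    smallerLeft σ v ⊆ Finset.Iio v := fun u hu => by
  simpa using (mem_smallerLeft.1 hu).1

/-- The number of letters smaller than `v` to the left of `v`, for all letters `v`. -/
def insertionCode {n : ℕ} (σ : Equiv.Perm (Fin n)) (v : Fin n) : Fin (v.val + 1) :=
  ⟨(smallerLeft σ v).card, by
    have := Finset.card_le_card (smallerLeft_subset σ v)
    rw [Fin.card_Iio] at this
    omega⟩

/-- The code determines the relative order of the letters, one letter at a time: the smaller letters
left of `v` form an initial segment of the already known order of the letters below `v`, and an
initial segment is determined by its size. -/
theorem insertionCode_injective (n : ℕ) :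
    Function.Injective (insertionCode : Equiv.Perm (Fin n) → (v : Fin n) → Fin (v.val + 1)) := by
  intro σ σ' h
  have hcard : ∀ v, (smallerLeft σ v).card = (smallerLeft σ' v).card := by
    intro v
    have := congrArg Fin.val (congrFun h v)
    exact this
  have key : ∀ N : ℕ, ∀ v : Fin n, v.val ≤ N → smallerLeft σ v = smallerLeft σ' v := by
    intro N
    induction N using Nat.strong_induction_on with
    | _ N ih =>
    intro v hv
    have hiff : ∀ u w : Fin n, u < v → w < v →
        (σ.symm u < σ.symm w ↔ σ'.symm u < σ'.symm w) := by
      intro u w hu hw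
      rcases lt_trichotomy u w with huw | rfl | huw
      · have := ih w.val (by omega) w le_rfl
        have h2 : u ∈ smallerLeft σ w ↔ u ∈ smallerLeft σ' w := by rw [this]
        simpa [mem_smallerLeft, huw] using h2
      · simp
      · have := ih u.val (by omega) u le_rfl
        have h2 : w ∈ smallerLeft σ u ↔ w ∈ smallerLeft σ' u := by rw [this]
        simp only [mem_smallerLeft, huw, true_and] at h2
        have hne : σ.symm u ≠ σ.symm w := fun e => huw.ne' (σ.symm.injective e)
        have hne' : σ'.symm u ≠ σ'.symm w := fun e => huw.ne' (σ'.symm.injective e)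
        rw [← not_le, ← not_le, not_iff_not, hne.symm.le_iff_lt, hne'.symm.le_iff_lt]
        exact h2
    -- Two initial segments of the same linear order are comparable.
    have hsub : smallerLeft σ v ⊆ smallerLeft σ' v ∨ smallerLeft σ' v ⊆ smallerLeft σ v := by
      by_contra! hcon
      obtain ⟨u, hu, hu'⟩ := Finset.not_subset.1 hcon.1
      obtain ⟨w, hw', hw⟩ := Finset.not_subset.1 hcon.2
      rw [mem_smallerLeft] at hu hu' hw hw'
      have h1 : σ.symm u < σ.symm w := by
        have : σ.symm v ≤ σ.symm w := not_lt.1 fun h => hw ⟨hw'.1, h⟩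
        exact hu.2.trans_le this
      have h2 : σ'.symm w < σ'.symm u := by
        have : σ'.symm v ≤ σ'.symm u := not_lt.1 fun h => hu' ⟨hu.1, h⟩
        exact hw'.2.trans_le this
      exact (((hiff u w hu.1 hw'.1).1 h1).trans h2).false
    rcases hsub with hs | hs
    · exact Finset.eq_of_subset_of_card_le hs (hcard v).ge
    · exact (Finset.eq_of_subset_of_card_le hs (hcard v).le).symm
  have hlt : ∀ u v : Fin n, u < v → (σ.symm u < σ.symm v ↔ σ'.symm u < σ'.symm v) := by
    intro u v huv
    have h2 : u ∈ smallerLeft σ v ↔ u ∈ smallerLeft σ' v := by rw [key v.val v le_rfl]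
    simpa [mem_smallerLeft, huv] using h2
  have hlt' : ∀ u v : Fin n, σ.symm u < σ.symm v → σ'.symm u < σ'.symm v := by
    intro u v huv
    rcases lt_trichotomy u v with h | rfl | h
    · exact (hlt u v h).1 huv
    · exact absurd huv (lt_irrefl _)
    · have h1 : ¬ σ'.symm v < σ'.symm u := fun h' => ((hlt v u h).2 h').asymm huv
      exact lt_of_le_of_ne (not_lt.1 h1) fun e => h.ne' (σ'.symm.injective e)
  -- Equal relative orders make this permutation increasing, and `Fin n` has no order automorphism
  -- except the identity.
  have hmono : StrictMono (σ.trans σ'.symm) := by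
    intro p q hpq
    have := hlt' (σ p) (σ q) (by simpa using hpq)
    simpa using this
  have hid : ∀ p, (σ.trans σ'.symm) p = p := by
    intro p
    have := Subsingleton.elim (hmono.orderIsoOfSurjective _ (σ.trans σ'.symm).surjective)
      (OrderIso.refl (Fin n))
    exact congrArg (fun f : Fin n ≃o Fin n => f p) this
  ext p
  have := congrArg σ' (hid p)
  simp only [Equiv.trans_apply, Equiv.apply_symm_apply] at this
  rw [this]

theorem insertionCode_bijective (n : ℕ) :
    Function.Bijective (insertionCode : Equiv.Perm (Fin n) → (v : Fin n) → Fin (v.val + 1)) := by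
  rw [Fintype.bijective_iff_injective_and_card]
  refine ⟨insertionCode_injective n, ?_⟩
  rw [Fintype.card_perm, Fintype.card_fin, Fintype.card_pi]
  simp only [Fintype.card_fin]
  rw [← Finset.prod_range_add_one_eq_factorial, Finset.prod_range]

theorem insertionCode_eq_zero_iff {n : ℕ} {σ : Equiv.Perm (Fin n)} {v : Fin n} :
    insertionCode σ v = 0 ↔ v.val + 1 ∈ lmin σ := by
  rw [Fin.ext_iff, insertionCode, Fin.val_zero, Finset.card_eq_zero,
    Finset.eq_empty_iff_forall_notMem, lmin]
  simp only [mem_smallerLeft, Set.mem_ofPred_eq]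
  constructor
  · intro h
    refine ⟨σ.symm v, by simp, fun q hq => ?_⟩
    rw [Equiv.apply_symm_apply]
    by_contra hle
    have hne : σ q ≠ v := by
      rintro rfl
      simp at hq
    exact h (σ q) ⟨lt_of_le_of_ne (not_lt.1 hle) hne, by simpa using hq⟩
  · rintro ⟨p, hp, h⟩ u ⟨hu, hup⟩
    have : v = σ p := Fin.ext (by omega)
    subst this
    have := h (σ.symm u) (by simpa using hup)
    rw [Equiv.apply_symm_apply] at this
    exact this.asymm hu

theorem insertionCode_eq_last_iff {n : ℕ} {σ : Equiv.Perm (Fin n)} {v : Fin n} :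
    insertionCode σ v = Fin.last _ ↔
      ∀ p, (σ p).val + 1 = v.val + 1 → ∀ q, p < q → v.val + 1 < (σ q).val + 1 := by
  have h1 : insertionCode σ v = Fin.last _ ↔ smallerLeft σ v = Finset.Iio v := by
    rw [Fin.ext_iff, insertionCode, Fin.val_last]
    constructor
    · intro h
      exact Finset.eq_of_subset_of_card_le (smallerLeft_subset σ v) (by rw [Fin.card_Iio]; exact h.ge)
    · intro h
      simp [h]
  rw [h1]
  constructor
  · intro h p hp q hpq
    have hv : v = σ p := Fin.ext (by omega)
    subst hv
    by_contra hle
    have hq : σ q < σ p := lt_of_le_of_ne (Fin.le_def.2 (by omega)) fun e =>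
      hpq.ne' (σ.injective e)
    have : σ q ∈ smallerLeft σ (σ p) := by
      rw [h]
      simpa using hq
    rw [mem_smallerLeft] at this
    simp only [Equiv.symm_apply_apply] at this
    exact this.2.asymm hpq
  · intro h
    refine (smallerLeft_subset σ v).antisymm fun u hu => ?_
    rw [Finset.mem_Iio] at hu
    rw [mem_smallerLeft]
    refine ⟨hu, ?_⟩
    by_contra hle
    have hne : σ.symm v ≠ σ.symm u := fun e => hu.ne' (σ.symm.injective e)
    have := h (σ.symm v) (by simp) (σ.symm u) (lt_of_le_of_ne (not_lt.1 hle) hne)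
    rw [Equiv.apply_symm_apply] at this
    have := Fin.lt_def.1 hu
    omega

/-- The code turns all conditions into independent ones on single letters: code 0 for a
left-to-right minimum, one of the `x i - 1` nonzero codes for `x i`, and the maximal code if nothing
smaller may follow `x i`. -/
theorem ncard_permutations_of_lmin {ℓ n : ℕ} {x : Fin ℓ → ℕ} (hx : StrictMono x)
    (hxn : ∀ i, x i ∈ Finset.Icc 2 n) (P : Fin ℓ → Prop) [DecidablePred P] :
    {σ : Equiv.Perm (Fin n) | lmin σ = ↑(Finset.Icc 1 n \ Finset.univ.image x) ∧
      ∀ i, P i → ∀ p, (σ p).val + 1 = x i → ∀ q, p < q → x i < (σ q).val + 1}.ncard =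
      ∏ i, if P i then 1 else x i - 1 := by
  classical
  simp only [Finset.mem_Icc] at hxn
  let e : Fin ℓ → Fin n := fun i => ⟨x i - 1, by have := hxn i; omega⟩
  have hex : ∀ i, (e i).val + 1 = x i := fun i => by
    have := hxn i
    simp only [e]
    omega
  have he : Function.Injective e := fun i j h => hx.injective (by rw [← hex, ← hex, h])
  let S : (v : Fin n) → Finset (Fin (v.val + 1)) := fun v =>
    if ∃ i, e i = v then (if ∃ i, e i = v ∧ P i then {Fin.last _} else {0}ᶜ) else {0}
  have hset : {σ : Equiv.Perm (Fin n) | lmin σ = ↑(Finset.Icc 1 n \ Finset.univ.image x) ∧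
      ∀ i, P i → ∀ p, (σ p).val + 1 = x i → ∀ q, p < q → x i < (σ q).val + 1} =
      insertionCode ⁻¹' ↑(Fintype.piFinset S) := by
    ext σ
    have hl : lmin σ = ↑(Finset.Icc 1 n \ Finset.univ.image x) ↔
        ∀ v, (insertionCode σ v = 0 ↔ ¬ ∃ i, e i = v) := by
      have hmem : ∀ v : Fin n, v.val + 1 ∈ (↑(Finset.Icc 1 n \ Finset.univ.image x) : Set ℕ) ↔
          ¬ ∃ i, e i = v := by
        intro v
        simp only [Finset.coe_sdiff, Finset.coe_Icc, Finset.coe_image, Set.mem_sdiff, Set.mem_Icc,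
          Finset.coe_univ, Set.image_univ, Set.mem_range]
        have hv : (∃ i, x i = v.val + 1) ↔ ∃ i, e i = v := by
          refine exists_congr fun i => ?_
          rw [Fin.ext_iff, ← hex i]
          omega
        rw [hv]
        have := v.isLt
        exact ⟨fun h => h.2, fun h => ⟨by omega, h⟩⟩
      constructor
      · intro h v
        rw [insertionCode_eq_zero_iff, h, hmem]
      · intro h
        ext z
        by_cases hz : 1 ≤ z ∧ z ≤ n
        · obtain ⟨v, rfl⟩ : ∃ v : Fin n, z = v.val + 1 := ⟨⟨z - 1, by omega⟩, by simp; omega⟩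
          rw [← insertionCode_eq_zero_iff, h, hmem]
        · refine iff_of_false ?_ ?_
          · rintro ⟨p, hp, -⟩
            have := (σ p).isLt
            omega
          · simp only [Finset.coe_sdiff, Finset.coe_Icc, Set.mem_sdiff, Set.mem_Icc]
            exact fun h => hz h.1
    have hc : (∀ i, P i → ∀ p, (σ p).val + 1 = x i → ∀ q, p < q → x i < (σ q).val + 1) ↔
        ∀ i, P i → insertionCode σ (e i) = Fin.last _ := by
      refine forall₂_congr fun i _ => ?_
      rw [insertionCode_eq_last_iff, hex]
    rw [Set.mem_ofPred_eq, hl, hc, Set.mem_preimage, Finset.mem_coe, Fintype.mem_piFinset]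
    constructor
    · rintro ⟨h1, h2⟩ v
      simp only [S]
      split_ifs with h3 h4
      · obtain ⟨i, rfl, hi⟩ := h4
        simpa using h2 i hi
      · simpa [h3] using h1 v
      · simpa [h3] using h1 v
    · intro h
      simp only [S] at h
      constructor
      · intro v
        have := h v
        split_ifs at this with h3 h4
        · obtain ⟨i, rfl, hi⟩ := h4
          rw [Finset.mem_singleton] at this
          simp only [h3, not_true_eq_false, iff_false]
          -- The maximal code is nonzero because `2 ≤ x i`, so the forced letter is indeed no
          -- left-to-right minimum.
          rw [this, Fin.ext_iff, Fin.val_last, Fin.val_zero]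
          have := hxn i
          have := hex i
          omega
        · simpa [h3] using this
        · simpa [h3] using this
      · intro i hi
        have := h (e i)
        rw [if_pos ⟨i, rfl⟩, if_pos ⟨i, rfl, hi⟩] at this
        simpa using this
  rw [hset, Set.ncard_preimage_of_injective_subset_range (insertionCode_injective n)
    (fun c _ => (insertionCode_bijective n).surjective c), Set.ncard_coe_finset,
    Fintype.card_piFinset]
  symm
  refine Fintype.prod_of_injective e he _ _ ?_ ?_
  · intro v hv
    have : ¬ ∃ i, e i = v := hv
    simp [S, this]
  · intro i
    have h1 : (∃ i', e i' = e i ∧ P i') ↔ P i :=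
      ⟨fun ⟨i', h, hP⟩ => he h ▸ hP, fun hP => ⟨i, rfl, hP⟩⟩
    simp only [S, exists_apply_eq_apply, if_true, h1]
    split_ifs with h
    · simp
    · rw [Finset.card_compl, Finset.card_singleton, Fintype.card_fin, ← hex]

/-! ### Partitions by the minima of their blocks -/

/-- The minimum of the block of `v` in the partition `π`. -/
noncomputable def blockMin {s : Finset ℕ} (π : Finpartition s) (v : ℕ) : ℕ :=
  sInf (π.part v : Set ℕ)

theorem mem_famMin_blocks {s : Finset ℕ} {π : Finpartition s} {v : ℕ} :
    v ∈ famMin (blocks π) ↔ ∃ C ∈ π.parts, IsLeast (C : Set ℕ) v := by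
  simp only [famMin, blocks, Finset.mem_map, Function.Embedding.coeFn_mk, Set.mem_ofPred_eq]
  constructor
  · rintro ⟨_, ⟨C, hC, rfl⟩, h⟩
    exact ⟨C, hC, h⟩
  · rintro ⟨C, hC, h⟩
    exact ⟨_, ⟨C, hC, rfl⟩, h⟩

theorem famRel_blocks {s : Finset ℕ} {π : Finpartition s} {u v : ℕ} :
    famRel (blocks π) u v ↔ ∃ C ∈ π.parts, u ∈ C ∧ v ∈ C := by
  simp only [famRel, blocks, Finset.mem_map, Function.Embedding.coeFn_mk]
  constructor
  · rintro ⟨_, ⟨C, hC, rfl⟩, h⟩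
    exact ⟨C, hC, h⟩
  · rintro ⟨C, hC, h⟩
    exact ⟨_, ⟨C, hC, rfl⟩, h⟩

theorem isLeast_blockMin {s : Finset ℕ} (π : Finpartition s) {v : ℕ} (hv : v ∈ s) :
    IsLeast (π.part v : Set ℕ) (blockMin π v) :=
  ⟨Nat.sInf_mem ⟨v, π.mem_part hv⟩, fun _ hu => Nat.sInf_le hu⟩

theorem blockMin_mem_famMin {s : Finset ℕ} (π : Finpartition s) {v : ℕ} (hv : v ∈ s) :
    blockMin π v ∈ famMin (blocks π) :=
  mem_famMin_blocks.2 ⟨_, π.part_mem.2 hv, isLeast_blockMin π hv⟩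

theorem blockMin_le {s : Finset ℕ} (π : Finpartition s) {v : ℕ} (hv : v ∈ s) :
    blockMin π v ≤ v :=
  (isLeast_blockMin π hv).2 (π.mem_part hv)

theorem blockMin_mem {s : Finset ℕ} (π : Finpartition s) {v : ℕ} (hv : v ∈ s) :
    blockMin π v ∈ s :=
  π.le (π.part_mem.2 hv) (isLeast_blockMin π hv).1

theorem blockMin_eq_self {s : Finset ℕ} {π : Finpartition s} {v : ℕ}
    (hv : v ∈ famMin (blocks π)) : blockMin π v = v := by
  obtain ⟨C, hC, h⟩ := mem_famMin_blocks.1 hv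
  have hCv : π.part v = C := π.part_eq_of_mem hC h.1
  exact IsLeast.unique (isLeast_blockMin π (π.le hC h.1)) (hCv ▸ h)

theorem mem_part_iff_blockMin {s : Finset ℕ} (π : Finpartition s) {u v : ℕ} (hu : u ∈ s)
    (hv : v ∈ s) : u ∈ π.part v ↔ blockMin π u = blockMin π v := by
  constructor
  · intro h
    rw [blockMin, blockMin, π.part_eq_of_mem (π.part_mem.2 hv) h]
  · intro h
    have h1 := (isLeast_blockMin π hu).1
    have h2 := (isLeast_blockMin π hv).1
    rw [h] at h1
    have e1 := π.part_eq_of_mem (π.part_mem.2 hu) h1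
    have e2 := π.part_eq_of_mem (π.part_mem.2 hv) h2
    rw [← e2, e1]
    exact π.mem_part hu

theorem finpartition_ext_blockMin {s : Finset ℕ} {π π' : Finpartition s}
    (h : ∀ v ∈ s, blockMin π v = blockMin π' v) : π = π' := by
  have key : ∀ {ρ ρ' : Finpartition s}, (∀ v ∈ s, blockMin ρ v = blockMin ρ' v) →
      ρ.parts ⊆ ρ'.parts := by
    intro ρ ρ' h C hC
    obtain ⟨v, hvC⟩ := ρ.nonempty_of_mem_parts hC
    have hv : v ∈ s := ρ.le hC hvC
    have : C = ρ'.part v := by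
      rw [← ρ.part_eq_of_mem hC hvC]
      ext u
      by_cases hu : u ∈ s
      · rw [mem_part_iff_blockMin ρ hu hv, mem_part_iff_blockMin ρ' hu hv, h u hu, h v hv]
      · exact iff_of_false (fun h' => hu (ρ.le (ρ.part_mem.2 hv) h'))
          fun h' => hu (ρ'.le (ρ'.part_mem.2 hv) h')
    rw [this]
    exact ρ'.part_mem.2 hv
  exact Finpartition.ext ((key h).antisymm (key fun v hv => (h v hv).symm))

/-- The blocks are the fibres of `r`: idempotence puts `r v` into the fibre of `v`, and `r v ≤ v`
makes it least there. -/
theorem exists_finpartition_blockMin (s : Finset ℕ) (r : ℕ → ℕ)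
    (hs : ∀ v ∈ s, r v ∈ s) (hle : ∀ v ∈ s, r v ≤ v) (hr : ∀ v ∈ s, r (r v) = r v) :
    ∃ π : Finpartition s, ∀ v ∈ s, blockMin π v = r v := by
  classical
  refine ⟨Finpartition.ofSetSetoid (Setoid.ker r) s, fun v hv => ?_⟩
  refine IsLeast.unique (isLeast_blockMin _ hv) ⟨?_, ?_⟩
  · rw [Finset.mem_coe, Finpartition.mem_part_ofSetSetoid_iff_rel]
    exact ⟨hv, hs v hv, (hr v hv).symm⟩
  · intro u hu
    rw [Finset.mem_coe, Finpartition.mem_part_ofSetSetoid_iff_rel] at hu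
    obtain ⟨-, hu, h⟩ := hu
    have h : r v = r u := h
    rw [h]
    exact hle u hu

theorem famMin_blocks_eq {s : Finset ℕ} (π : Finpartition s) :
    famMin (blocks π) = blockMin π '' s := by
  ext v
  constructor
  · intro hv
    obtain ⟨C, hC, h⟩ := mem_famMin_blocks.1 hv
    exact ⟨v, π.le hC h.1, blockMin_eq_self hv⟩
  · rintro ⟨u, hu, rfl⟩
    exact blockMin_mem_famMin π hu

/-- Of the `x i - 1` positive integers below `x i`, exactly `i` are earlier terms of `x` (indices
start at 0). -/
theorem card_below {ℓ n : ℕ} {x : Fin ℓ → ℕ} (hx : StrictMono x)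
    (hxn : ∀ i, x i ∈ Finset.Icc 2 n) (i : Fin ℓ) :
    ((Finset.Icc 1 n \ Finset.univ.image x).filter (· < x i)).card = x i - 1 - i.val := by
  have h : (Finset.Icc 1 n \ Finset.univ.image x).filter (· < x i) =
      Finset.Ico 1 (x i) \ (Finset.Iio i).image x := by
    ext v
    have := Finset.mem_Icc.1 (hxn i)
    simp only [Finset.mem_filter, Finset.mem_sdiff, Finset.mem_Icc, Finset.mem_image,
      Finset.mem_univ, true_and, Finset.mem_Ico, Finset.mem_Iio]
    constructor
    · rintro ⟨⟨h1, h2⟩, h3⟩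
      exact ⟨⟨h1.1, h3⟩, fun ⟨j, _, hj⟩ => h2 ⟨j, hj⟩⟩
    · rintro ⟨h1, h2⟩
      exact ⟨⟨⟨h1.1, by omega⟩, fun ⟨j, hj⟩ => h2 ⟨j, hx.lt_iff_lt.1 (by omega), hj⟩⟩, h1.2⟩
  rw [h, Finset.card_sdiff_of_subset, Nat.card_Ico, Finset.card_image_of_injective _ hx.injective,
    Fin.card_Iio]
  intro v hv
  obtain ⟨j, hj, rfl⟩ := Finset.mem_image.1 hv
  have h1 := Finset.mem_Icc.1 (hxn j)
  exact Finset.mem_Ico.2 ⟨by omega, hx (Finset.mem_Iio.1 hj)⟩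

/-- A partition with given block minima D is a free choice, for each nonminimum, of a smaller
element of D as its block minimum. The relation to 1 forces this choice to be 1. -/
theorem ncard_partitions_of_famMin {ℓ n : ℕ} {x : Fin ℓ → ℕ} (hx : StrictMono x)
    (hxn : ∀ i, x i ∈ Finset.Icc 2 n) (P : Fin ℓ → Prop) [DecidablePred P] :
    {π : Finpartition (Finset.Icc 1 n) |
      famMin (blocks π) = ↑(Finset.Icc 1 n \ Finset.univ.image x) ∧
      ∀ i, P i → famRel (blocks π) (x i) 1}.ncard =
      ∏ i, if P i then 1 else x i - 1 - i.val := by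
  classical
  set D := Finset.Icc 1 n \ Finset.univ.image x with hD
  have hxD : ∀ i, x i ∉ D := fun i => by simp [hD]
  have hxs : ∀ i, x i ∈ Finset.Icc 1 n := fun i => by
    have := Finset.mem_Icc.1 (hxn i)
    exact Finset.mem_Icc.2 ⟨by omega, this.2⟩
  have hDs : D ⊆ Finset.Icc 1 n := Finset.sdiff_subset
  have hcases : ∀ v ∈ Finset.Icc 1 n, v ∈ D ∨ ∃ i, x i = v := by
    intro v hv
    by_cases h : ∃ i, x i = v
    · exact Or.inr h
    · exact Or.inl (by simpa [hD] using ⟨Finset.mem_Icc.1 hv, fun i hi => h ⟨i, hi⟩⟩)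
  have h1D : 0 < ℓ → 1 ∈ D := by
    intro hℓ
    have := Finset.mem_Icc.1 (hxn ⟨0, hℓ⟩)
    simp only [hD, Finset.mem_sdiff, Finset.mem_Icc, Finset.mem_image, Finset.mem_univ, true_and]
    refine ⟨by omega, fun ⟨i, hi⟩ => ?_⟩
    have := Finset.mem_Icc.1 (hxn i)
    omega
  let S : Fin ℓ → Finset ℕ := fun i => if P i then {1} else D.filter (· < x i)
  have hS : (Fintype.piFinset S).card = ∏ i, if P i then 1 else x i - 1 - i.val := by
    rw [Fintype.card_piFinset]
    refine Finset.prod_congr rfl fun i _ => ?_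
    simp only [S]
    split_ifs
    · simp
    · exact card_below hx hxn i
  rw [← hS, ← Set.ncard_coe_finset]
  refine Set.ncard_congr (fun π _ i => blockMin π (x i)) ?_ ?_ ?_
  · rintro π ⟨h1, h2⟩
    rw [Finset.mem_coe, Fintype.mem_piFinset]
    intro i
    simp only [S]
    split_ifs with hi
    · obtain ⟨C, hC, hxC, h1C⟩ := famRel_blocks.1 (h2 i hi)
      have hle : blockMin π (x i) ≤ 1 :=
        (isLeast_blockMin π (hxs i)).2 (by rwa [π.part_eq_of_mem hC hxC])
      have := Finset.mem_Icc.1 (blockMin_mem π (hxs i))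
      rw [Finset.mem_singleton]
      omega
    · have h3 : blockMin π (x i) ∈ D := by
        have := blockMin_mem_famMin π (hxs i)
        rwa [h1] at this
      refine Finset.mem_filter.2 ⟨h3, lt_of_le_of_ne (blockMin_le π (hxs i)) fun e => ?_⟩
      exact hxD i (e ▸ h3)
  · rintro π π' ⟨h1, -⟩ ⟨h1', -⟩ h
    refine finpartition_ext_blockMin fun v hv => ?_
    rcases hcases v hv with hvD | ⟨i, rfl⟩
    · rw [blockMin_eq_self (by rw [h1]; exact hvD), blockMin_eq_self (by rw [h1']; exact hvD)]
    · exact congrFun h i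
  · intro f hf
    rw [Finset.mem_coe, Fintype.mem_piFinset] at hf
    have hfD : ∀ i, f i ∈ D ∧ f i < x i := by
      intro i
      have := hf i
      simp only [S] at this
      split_ifs at this
      · rw [Finset.mem_singleton] at this
        rw [this]
        have h2 := Finset.mem_Icc.1 (hxn i)
        exact ⟨h1D (by have := i.isLt; omega), by omega⟩
      · exact Finset.mem_filter.1 this
    -- The prescribed block-minimum function: `f` on the nonminima, the identity on D.
    let r : ℕ → ℕ := Function.extend x f id
    have hrx : ∀ i, r (x i) = f i := fun i => hx.injective.extend_apply _ _ _
    have hrD : ∀ v ∈ D, r v = v := fun v hv =>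
      Function.extend_apply' _ _ _ fun ⟨i, hi⟩ => hxD i (hi ▸ hv)
    have hrmem : ∀ v ∈ Finset.Icc 1 n, r v ∈ D := by
      intro v hv
      rcases hcases v hv with hvD | ⟨i, rfl⟩
      · rwa [hrD v hvD]
      · rw [hrx]
        exact (hfD i).1
    obtain ⟨π, hπ⟩ := exists_finpartition_blockMin (Finset.Icc 1 n) r
      (fun v hv => hDs (hrmem v hv))
      (fun v hv => by
        rcases hcases v hv with hvD | ⟨i, rfl⟩
        · rw [hrD v hvD]
        · rw [hrx]
          exact (hfD i).2.le)
      (fun v hv => hrD _ (hrmem v hv))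
    refine ⟨π, ⟨?_, ?_⟩, ?_⟩
    · rw [famMin_blocks_eq]
      ext v
      constructor
      · rintro ⟨u, hu, rfl⟩
        rw [hπ u hu]
        exact hrmem u hu
      · intro hv
        exact ⟨v, hDs hv, by rw [hπ v (hDs hv), hrD v hv]⟩
    · intro i hi
      have h1 : f i = 1 := by
        have := hf i
        simpa [S, hi] using this
      refine famRel_blocks.2 ⟨π.part (x i), π.part_mem.2 (hxs i), π.mem_part (hxs i), ?_⟩
      have := (isLeast_blockMin π (hxs i)).1
      rwa [hπ _ (hxs i), hrx, h1] at this
    · funext i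
      rw [hπ _ (hxs i), hrx]

/-! ### Segmented families by multiplicities -/

/-- The family of the blocks consisting of an element `d` of `D` and `e d` copies of `s d`. -/
def segFamily (D : Finset ℕ) (s : ℕ → ℕ) (e : ℕ →₀ ℕ) : Finset (Multiset ℕ) :=
  D.image fun d => d ::ₘ Multiset.replicate (e d) (s d)

/-- `s d` is the smallest element of `U \ D` above `d`, for all `d ∈ D`. -/
def IsNextOutside (U D : Finset ℕ) (s : ℕ → ℕ) : Prop :=
  ∀ d ∈ D, s d ∈ U ∧ s d ∉ D ∧ d < s d ∧ ∀ z, d < z → z < s d → z ∈ D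

section segFamily

variable {U D : Finset ℕ} {s : ℕ → ℕ}

theorem mem_segFamily {e : ℕ →₀ ℕ} {C : Multiset ℕ} :
    C ∈ segFamily D s e ↔ ∃ d ∈ D, d ::ₘ Multiset.replicate (e d) (s d) = C := by
  simp [segFamily]

theorem mem_segBlock {d m z a : ℕ} :
    z ∈ d ::ₘ Multiset.replicate m a ↔ z = d ∨ m ≠ 0 ∧ z = a := by
  rw [Multiset.mem_cons, Multiset.mem_replicate]

theorem segBlock_injOn (hs : IsNextOutside U D s) {d d' m m' : ℕ} (hd : d ∈ D) (hd' : d' ∈ D)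
    (h : d ::ₘ Multiset.replicate m (s d) = d' ::ₘ Multiset.replicate m' (s d')) :
    d = d' ∧ m = m' := by
  constructor
  · have : d ∈ d' ::ₘ Multiset.replicate m' (s d') := h ▸ Multiset.mem_cons_self _ _
    rcases mem_segBlock.1 this with h1 | ⟨-, h1⟩
    · exact h1
    · exact absurd hd (h1 ▸ (hs d' hd').2.1)
  · simpa using congrArg Multiset.card h

theorem segFamily_injective (hs : IsNextOutside U D s) {e e' : ℕ →₀ ℕ} (he : e.support ⊆ D)
    (he' : e'.support ⊆ D) (h : segFamily D s e = segFamily D s e') : e = e' := by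
  ext d
  by_cases hd : d ∈ D
  · have : d ::ₘ Multiset.replicate (e d) (s d) ∈ segFamily D s e' := by
      rw [← h]
      exact mem_segFamily.2 ⟨d, hd, rfl⟩
    obtain ⟨d', hd', h'⟩ := mem_segFamily.1 this
    obtain ⟨rfl, h2⟩ := segBlock_injOn hs hd' hd h'
    exact h2.symm
  · rw [Finsupp.notMem_support_iff.1 fun h' => hd (he h'),
      Finsupp.notMem_support_iff.1 fun h' => hd (he' h')]

theorem famSum_segFamily (hs : IsNextOutside U D s) (e : ℕ →₀ ℕ) :
    famSum (segFamily D s e) = D.val + ∑ d ∈ D, Multiset.replicate (e d) (s d) := by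
  rw [famSum, segFamily, Finset.sum_image]
  · simp only [← Multiset.singleton_add]
    rw [Finset.sum_add_distrib, Finset.sum_multiset_singleton]
  · intro d hd d' hd' h
    exact (segBlock_injOn hs hd hd' h).1

theorem isLeast_segBlock (hs : IsNextOutside U D s) {d m : ℕ} (hd : d ∈ D) :
    IsLeast {z | z ∈ d ::ₘ Multiset.replicate m (s d)} d := by
  refine ⟨Set.mem_ofPred_eq ▸ Multiset.mem_cons_self d _, fun z hz => ?_⟩
  rcases mem_segBlock.1 hz with h | ⟨-, h⟩
  · exact h.ge
  · rw [h]
    exact (hs d hd).2.2.1.le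

theorem famMin_segFamily (hs : IsNextOutside U D s) (e : ℕ →₀ ℕ) :
    famMin (segFamily D s e) = D := by
  ext z
  constructor
  · rintro ⟨C, hC, hz⟩
    obtain ⟨d, hd, rfl⟩ := mem_segFamily.1 hC
    rwa [hz.unique (isLeast_segBlock hs hd)]
  · intro hz
    exact ⟨_, mem_segFamily.2 ⟨z, hz, rfl⟩, isLeast_segBlock hs hz⟩

theorem segmented_segFamily (hs : IsNextOutside U D s) (hDU : D ⊆ U) (e : ℕ →₀ ℕ) :
    Segmented U (segFamily D s e) := by
  constructor
  · intro C hC z hz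
    obtain ⟨d, hd, rfl⟩ := mem_segFamily.1 hC
    rcases mem_segBlock.1 hz with h | ⟨-, h⟩
    · rw [h]
      exact hDU hd
    · rw [h]
      exact (hs d hd).1
  · rintro x - y - z - hxy hyz ⟨C, hC, hx, hz⟩
    obtain ⟨d, hd, rfl⟩ := mem_segFamily.1 hC
    rw [famMin_segFamily hs]
    have hlt := (hs d hd).2.2.1
    rcases mem_segBlock.1 hx with h | ⟨-, h⟩ <;> rcases mem_segBlock.1 hz with h' | ⟨-, h'⟩
    · omega
    · exact (hs d hd).2.2.2 y (h ▸ hxy) (h' ▸ hyz)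
    · omega
    · omega

theorem famRel_segFamily (hs : IsNextOutside U D s) (e : ℕ →₀ ℕ) {d : ℕ} (hd : d ∈ D) :
    famRel (segFamily D s e) (s d) d ↔ 1 ≤ e d := by
  constructor
  · rintro ⟨C, hC, h1, h2⟩
    obtain ⟨d', hd', rfl⟩ := mem_segFamily.1 hC
    rcases mem_segBlock.1 h2 with rfl | ⟨-, h2⟩
    · rcases mem_segBlock.1 h1 with h1 | ⟨h1, -⟩
      · have := (hs d hd).2.2.1
        omega
      · omega
    · exact absurd hd (h2 ▸ (hs d' hd').2.1)
  · intro h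
    exact ⟨_, mem_segFamily.2 ⟨d, hd, rfl⟩, mem_segBlock.2 (Or.inr ⟨by omega, rfl⟩),
      Multiset.mem_cons_self _ _⟩

theorem nodup_segFamily_iff (hs : IsNextOutside U D s) (e : ℕ →₀ ℕ) :
    (∀ C ∈ segFamily D s e, C.Nodup) ↔ ∀ d ∈ D, e d ≤ 1 := by
  simp only [segFamily, Finset.forall_mem_image]
  refine forall₂_congr fun d hd => ?_
  have h1 := (hs d hd).2.2.1
  rw [Multiset.nodup_cons]
  constructor
  · rintro ⟨-, h⟩
    have := Multiset.nodup_iff_count_le_one.1 h (s d)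
    rwa [Multiset.count_replicate_self] at this
  · intro h
    refine ⟨fun h' => ?_, Multiset.nodup_iff_count_le_one.2 fun z => ?_⟩
    · have := Multiset.eq_of_mem_replicate h'
      omega
    · rw [Multiset.count_replicate]
      split_ifs <;> omega

theorem ne_zero_of_mem_segFamily {e : ℕ →₀ ℕ} {C : Multiset ℕ} (hC : C ∈ segFamily D s e) :
    C ≠ 0 := by
  obtain ⟨d, -, rfl⟩ := mem_segFamily.1 hC
  exact Multiset.cons_ne_zero

/-- Each element of D is available once and is used up as a block minimum, so a block consists of
its minimum `d` and elements outside D. None of these lies below `s d`, by the choice of `s`; none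
lies above, since segmentation would then make `s d` a minimum. Hence all are copies of `s d`. -/
theorem exists_eq_segFamily (hs : IsNextOutside U D s) {T : Multiset ℕ} (hT : ∀ z ∈ T, z ∉ D)
    {F : Finset (Multiset ℕ)} (h0 : ∀ C ∈ F, C ≠ 0) (hseg : Segmented U F) (hmin : famMin F = D)
    (hsum : famSum F ≤ D.val + T) : ∃ e : ℕ →₀ ℕ, e.support ⊆ D ∧ F = segFamily D s e := by
  classical
  have hcount : ∀ d ∈ D, ∑ C ∈ F, C.count d ≤ 1 := by
    intro d hd
    have h1 := Multiset.count_le_of_le d hsum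
    rw [famSum, Multiset.count_sum', Multiset.count_add,
      Multiset.count_eq_zero_of_notMem (fun h => hT d h hd)] at h1
    exact h1.trans (Multiset.nodup_iff_count_le_one.1 D.nodup d)
  have huniq : ∀ d ∈ D, ∀ C ∈ F, ∀ C' ∈ F, d ∈ C → d ∈ C' → C = C' := by
    intro d hd C hC C' hC' hdC hdC'
    by_contra hne
    have h1 : ∑ C ∈ {C, C'}, C.count d ≤ ∑ C ∈ F, C.count d := by
      refine Finset.sum_le_sum_of_subset fun E hE => ?_
      rcases Finset.mem_insert.1 hE with rfl | hE
      · exact hC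
      · exact (Finset.mem_singleton.1 hE) ▸ hC'
    rw [Finset.sum_pair hne] at h1
    have h2 := hcount d hd
    have h3 := Multiset.count_pos.2 hdC
    have h4 := Multiset.count_pos.2 hdC'
    omega
  have hcountC : ∀ d ∈ D, ∀ C ∈ F, C.count d ≤ 1 := fun d hd C hC =>
    (Finset.single_le_sum (f := fun C : Multiset ℕ => C.count d) (fun _ _ => Nat.zero_le _)
      hC).trans (hcount d hd)
  have hleast : ∀ C ∈ F, ∃ d ∈ D, IsLeast {z | z ∈ C} d := by
    intro C hC
    obtain ⟨z, hz⟩ := Multiset.exists_mem_of_ne_zero (h0 C hC)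
    have hl : IsLeast {z | z ∈ C} (sInf {z | z ∈ C}) :=
      ⟨Nat.sInf_mem (s := {z | z ∈ C}) ⟨z, hz⟩, fun _ h => Nat.sInf_le h⟩
    refine ⟨_, ?_, hl⟩
    rw [← Finset.mem_coe, ← hmin]
    exact ⟨C, hC, hl⟩
  have hform : ∀ C ∈ F, ∀ d ∈ D, IsLeast {z | z ∈ C} d →
      d ::ₘ Multiset.replicate (C.card - 1) (s d) = C := by
    intro C hC d hd hl
    have hdC : d ∈ C := hl.1
    obtain ⟨C', rfl⟩ := Multiset.exists_cons_of_mem hdC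
    rw [Multiset.card_cons, Nat.add_sub_cancel]
    congr 1
    symm
    rw [Multiset.eq_replicate]
    refine ⟨rfl, fun z hz => ?_⟩
    have hzC : z ∈ d ::ₘ C' := Multiset.mem_cons_of_mem hz
    have hzd : z ≠ d := by
      rintro rfl
      have := hcountC z hd _ hC
      rw [Multiset.count_cons_self] at this
      have := Multiset.count_pos.2 hz
      omega
    have hdz : d < z := lt_of_le_of_ne (hl.2 hzC) hzd.symm
    have hzD : z ∉ D := by
      intro hzD
      have : z ∈ famMin F := by
        rw [hmin]
        exact hzD
      obtain ⟨E, hE, hEl⟩ := this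
      have := huniq z hzD E hE _ hC hEl.1 hzC
      subst this
      exact hzd (hEl.unique hl)
    obtain ⟨h1, h2, h3, h4⟩ := hs d hd
    rcases lt_trichotomy z (s d) with h | h | h
    · exact absurd (h4 z hdz h) hzD
    · exact h
    -- Here `d < s d < z` with `d` and `z` in one block, so segmentation applies to `s d`.
    · have hmem : s d ∈ famMin F :=
        hseg.2 d (hseg.1 _ hC d hdC) (s d) h1 z (hseg.1 _ hC z hzC) h3 h ⟨_, hC, hdC, hzC⟩
      rw [hmin] at hmem
      exact absurd hmem h2
  have hblock : ∀ d ∈ D, ∃ C ∈ F, IsLeast {z | z ∈ C} d := by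
    intro d hd
    have : d ∈ famMin F := by
      rw [hmin]
      exact hd
    exact this
  choose! c hcF hcl using hblock
  refine ⟨Finsupp.onFinset D (fun d => if d ∈ D then (c d).card - 1 else 0)
    (fun d hd => by_contra fun h => hd (if_neg h)), Finsupp.support_onFinset_subset, ?_⟩
  ext C
  rw [mem_segFamily]
  constructor
  · intro hC
    obtain ⟨d, hd, hl⟩ := hleast C hC
    refine ⟨d, hd, ?_⟩
    rw [Finsupp.onFinset_apply, if_pos hd,
      huniq d hd (c d) (hcF d hd) C hC (hcl d hd).1 hl.1]
    exact hform C hC d hd hl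
  · rintro ⟨d, hd, rfl⟩
    rw [Finsupp.onFinset_apply, if_pos hd, hform _ (hcF d hd) d hd (hcl d hd)]
    exact hcF d hd

end segFamily

/-! ### Counting multiplicity functions -/

/-- A function on `D` is the sum of its restrictions to the fibres of `g`, which can be chosen
independently. -/
theorem ncard_finsupp_of_fibers {ι : Type*} [Fintype ι] [DecidableEq ι] (D : Finset ℕ) (g : ℕ → ι)
    (Q : ι → Finset (ℕ →₀ ℕ)) (hQ : ∀ i, ∀ f ∈ Q i, f.support ⊆ D.filter (g · = i)) :
    {e : ℕ →₀ ℕ | e.support ⊆ D ∧ ∀ i, e.filter (g · = i) ∈ Q i}.ncard = ∏ i, (Q i).card := by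
  rw [← Fintype.card_piFinset, ← Set.ncard_coe_finset]
  have hzero : ∀ i, ∀ f ∈ Q i, ∀ v, (v ∉ D ∨ g v ≠ i) → f v = 0 := by
    intro i f hf v hv
    by_contra hne
    have := hQ i f hf (Finsupp.mem_support_iff.2 hne)
    rw [Finset.mem_filter] at this
    tauto
  refine Set.ncard_congr (fun e _ i => e.filter (g · = i)) ?_ ?_ ?_
  · rintro e ⟨-, he⟩
    rw [Finset.mem_coe, Fintype.mem_piFinset]
    exact he
  · rintro e e' - - h
    ext v
    have := congrArg (fun f : ℕ →₀ ℕ => f v) (congrFun h (g v))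
    simpa using this
  · intro f hf
    rw [Finset.mem_coe, Fintype.mem_piFinset] at hf
    have hfil : ∀ i, (∑ j, f j).filter (g · = i) = f i := by
      intro i
      ext v
      rw [Finsupp.filter_apply, Finsupp.finsetSum_apply]
      split_ifs with h
      · exact Finset.sum_eq_single i (fun j _ hj => hzero j _ (hf j) v (Or.inr (h ▸ hj.symm)))
          fun h => absurd (Finset.mem_univ _) h
      · exact (hzero i _ (hf i) v (Or.inr h)).symm
    refine ⟨∑ j, f j, ⟨?_, fun i => ?_⟩, funext hfil⟩
    · intro v hv
      by_contra hvD
      rw [Finsupp.mem_support_iff, Finsupp.finsetSum_apply] at hv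
      exact hv (Finset.sum_eq_zero fun j _ => hzero j _ (hf j) v (Or.inl hvD))
    · rw [hfil]
      exact hf i

/-- The functions with support in `A` and sum at most `T`. -/
def sumLE (A : Finset ℕ) (T : ℕ) : Finset (ℕ →₀ ℕ) :=
  (Finset.range (T + 1)).biUnion fun r => A.finsuppAntidiag r

theorem mem_sumLE {A : Finset ℕ} {T : ℕ} {f : ℕ →₀ ℕ} :
    f ∈ sumLE A T ↔ f.support ⊆ A ∧ ∑ d ∈ A, f d ≤ T := by
  simp only [sumLE, Finset.mem_biUnion, Finset.mem_range, Finset.mem_finsuppAntidiag]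
  constructor
  · rintro ⟨r, hr, h1, h2⟩
    exact ⟨h2, h1.trans_le (Nat.le_of_lt_succ hr)⟩
  · rintro ⟨h1, h2⟩
    exact ⟨_, Nat.lt_succ_of_le h2, rfl, h1⟩

theorem card_sumLE (A : Finset ℕ) (T : ℕ) : (sumLE A T).card = (T + A.card).choose A.card := by
  rw [sumLE, Finset.card_biUnion]
  · simp only [Finset.card_finsuppAntidiag_nat_eq_multichoose]
    exact Nat.sum_range_multichoose T A.card
  · intro r _ r' _ hne
    rw [Function.onFun, Finset.disjoint_left]
    intro f hf hf'
    rw [Finset.mem_finsuppAntidiag] at hf hf'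
    exact hne.symm (hf'.1.symm.trans hf.1)

/-- The functions with support in `A`, values at most `1` and sum `T`. -/
def zeroOneSum (A : Finset ℕ) (T : ℕ) : Finset (ℕ →₀ ℕ) :=
  (A.finsuppAntidiag T).filter fun f => ∀ d ∈ A, f d ≤ 1

theorem mem_zeroOneSum {A : Finset ℕ} {T : ℕ} {f : ℕ →₀ ℕ} :
    f ∈ zeroOneSum A T ↔ f.support ⊆ A ∧ ∑ d ∈ A, f d = T ∧ ∀ d ∈ A, f d ≤ 1 := by
  rw [zeroOneSum, Finset.mem_filter, Finset.mem_finsuppAntidiag]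
  tauto

theorem card_zeroOneSum (A : Finset ℕ) (T : ℕ) : (zeroOneSum A T).card = A.card.choose T := by
  classical
  rw [← Finset.card_powersetCard]
  have hval : ∀ f ∈ zeroOneSum A T, ∀ d, f d = if d ∈ f.support then 1 else 0 := by
    intro f hf d
    rw [mem_zeroOneSum] at hf
    split_ifs with h
    · have h1 := hf.2.2 d (hf.1 h)
      have h2 := Finsupp.mem_support_iff.1 h
      omega
    · exact Finsupp.notMem_support_iff.1 h
  refine Finset.card_bij (fun f _ => f.support) ?_ ?_ ?_
  · intro f hf
    have hv := hval f hf
    rw [mem_zeroOneSum] at hf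
    rw [Finset.mem_powersetCard]
    refine ⟨hf.1, ?_⟩
    rw [← hf.2.1, Finset.sum_congr rfl fun d _ => hv d, Finset.sum_boole,
      Finset.filter_mem_eq_inter, Finset.inter_eq_right.2 hf.1, Nat.cast_id]
  · intro f hf f' hf' h
    ext d
    rw [hval f hf, hval f' hf', h]
  · intro B hB
    rw [Finset.mem_powersetCard] at hB
    have hsupp : (Finsupp.indicator B fun _ _ => (1 : ℕ)).support = B := by
      ext d
      simp [Finsupp.indicator_apply]
    refine ⟨Finsupp.indicator B fun _ _ => 1, mem_zeroOneSum.2 ⟨hsupp.subset.trans hB.1, ?_, ?_⟩,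
      hsupp⟩
    · simp only [Finsupp.indicator_apply, dite_eq_ite]
      rw [Finset.sum_boole, Finset.filter_mem_eq_inter, Finset.inter_eq_right.2 hB.1, Nat.cast_id,
        hB.2]
    · intro d _
      rw [Finsupp.indicator_apply]
      split_ifs <;> omega

/-- This settles the gap below x_1: the single available copy of x_1 has to join the block of 1,
which leaves one possibility. -/
theorem sum_le_one_and_pos_iff {A : Finset ℕ} {d : ℕ} (hd : d ∈ A) {f : ℕ →₀ ℕ}
    (hf : f.support ⊆ A) : (∑ v ∈ A, f v ≤ 1 ∧ 1 ≤ f d) ↔ f = Finsupp.single d 1 := by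
  constructor
  · rintro ⟨h1, h2⟩
    rw [← Finset.add_sum_erase A _ hd] at h1
    have h0 : ∑ v ∈ A.erase d, f v = 0 := by omega
    rw [Finset.sum_eq_zero_iff] at h0
    ext v
    rw [Finsupp.single_apply]
    split_ifs with h
    · subst h
      omega
    · by_cases hv : v ∈ A
      · exact h0 v (Finset.mem_erase.2 ⟨fun e => h e.symm, hv⟩)
      · exact Finsupp.notMem_support_iff.1 fun h' => hv (hf h')
  · rintro rfl
    simp [Finsupp.single_apply, hd]

/-! ### Counting segmented families -/

theorem sum_replicate_le_iff {ι : Type*} [Fintype ι] {y : ι → ℕ} (hy : Function.Injective y)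
    (p q : ι → ℕ) : ∑ i, Multiset.replicate (p i) (y i) ≤ ∑ i, Multiset.replicate (q i) (y i) ↔
      ∀ i, p i ≤ q i := by
  classical
  have hc : ∀ (p : ι → ℕ) i, (∑ i, Multiset.replicate (p i) (y i)).count (y i) = p i := by
    intro p i
    rw [Multiset.count_sum', Finset.sum_eq_single i, Multiset.count_replicate_self]
    · intro j _ hj
      rw [Multiset.count_replicate, if_neg fun h => hj (hy h)]
    · exact fun h => absurd (Finset.mem_univ _) h
  constructor
  · intro h i
    have := Multiset.count_le_of_le (y i) h
    rwa [hc, hc] at this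
  · intro h
    exact Finset.sum_le_sum fun i _ => Multiset.replicate_le_replicate (y i) |>.2 (h i)

theorem sum_replicate_eq_iff {ι : Type*} [Fintype ι] {y : ι → ℕ} (hy : Function.Injective y)
    (p q : ι → ℕ) : ∑ i, Multiset.replicate (p i) (y i) = ∑ i, Multiset.replicate (q i) (y i) ↔
      ∀ i, p i = q i := by
  rw [le_antisymm_iff, sum_replicate_le_iff hy, sum_replicate_le_iff hy, ← forall_and]
  exact forall_congr' fun i => le_antisymm_iff.symm

theorem prolong_strictMono {ℓ n : ℕ} {x : Fin ℓ → ℕ} (hx : StrictMono x) (hxn : ∀ i, x i < n) :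
    StrictMono (prolong x n) := by
  rw [Fin.strictMono_iff_lt_succ]
  intro i
  rw [prolong, Fin.snoc_castSucc]
  induction ℓ with
  | zero => exact i.elim0
  | succ ℓ _ =>
    induction i using Fin.lastCases with
    | last =>
      rw [Fin.succ_last, Fin.snoc_last]
      exact hxn _
    | cast j =>
      rw [Fin.succ_castSucc, Fin.snoc_castSucc]
      exact hx Fin.castSucc_lt_succ

section gaps

variable {ℓ n : ℕ} {x : Fin ℓ → ℕ}

theorem mem_compl_iff_prolong (v : ℕ) :
    v ∈ Finset.Icc 1 n \ Finset.univ.image x ↔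
      v ∈ Finset.Icc 1 (n + 1) ∧ ∀ i, prolong x (n + 1) i ≠ v := by
  simp only [Finset.mem_sdiff, Finset.mem_Icc, Finset.mem_image, Finset.mem_univ, true_and,
    Fin.forall_fin_succ', prolong, Fin.snoc_castSucc, Fin.snoc_last, not_exists]
  constructor
  · rintro ⟨h1, h2⟩
    exact ⟨by omega, h2, by omega⟩
  · rintro ⟨h1, h2, h3⟩
    exact ⟨by omega, h2⟩

theorem prolong_mem_Icc (hxn : ∀ i, x i ∈ Finset.Icc 2 n) (hn : 1 ≤ n) (i : Fin (ℓ + 1)) :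
    prolong x (n + 1) i ∈ Finset.Icc 2 (n + 1) := by
  induction i using Fin.lastCases with
  | last =>
    rw [prolong, Fin.snoc_last, Finset.mem_Icc]
    omega
  | cast j =>
    have := Finset.mem_Icc.1 (hxn j)
    rw [prolong, Fin.snoc_castSucc, Finset.mem_Icc]
    omega

/-- The gap of `d` is labelled by the first term above it of the sequence prolonged by `n + 1`; the
added term ensures existence. -/
theorem exists_gap_index (n : ℕ) (x : Fin ℓ → ℕ) : ∃ g : ℕ → Fin (ℓ + 1),
    ∀ d ∈ Finset.Icc 1 n \ Finset.univ.image x, d < prolong x (n + 1) (g d) ∧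
      ∀ j, d < prolong x (n + 1) j → g d ≤ j := by
  have : ∀ d, ∃ i : Fin (ℓ + 1), d ∈ Finset.Icc 1 n \ Finset.univ.image x →
      d < prolong x (n + 1) i ∧ ∀ j, d < prolong x (n + 1) j → i ≤ j := by
    intro d
    by_cases hd : d ∈ Finset.Icc 1 n \ Finset.univ.image x
    · have hlast : d < prolong x (n + 1) (Fin.last ℓ) := by
        have := Finset.mem_Icc.1 (Finset.mem_sdiff.1 hd).1
        rw [prolong, Fin.snoc_last]
        omega
      obtain ⟨i, hi, hmin⟩ := Finset.exists_minimal
        (s := Finset.univ.filter fun i => d < prolong x (n + 1) i)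
        ⟨Fin.last ℓ, by simpa using hlast⟩
      refine ⟨i, fun _ => ⟨by simpa using hi, fun j hj => ?_⟩⟩
      rcases le_total i j with h | h
      · exact h
      · exact hmin (by simpa using hj) h
    · exact ⟨0, fun h => absurd h hd⟩
  choose g hg using this
  exact ⟨g, hg⟩

theorem prolong_strictMono' (hx : StrictMono x) (hxn : ∀ i, x i ∈ Finset.Icc 2 n) : StrictMono (prolong x (n + 1)) :=
  prolong_strictMono hx fun i => by
    have := Finset.mem_Icc.1 (hxn i)
    omega

theorem isNextOutside_prolong (hx : StrictMono x) (hxn : ∀ i, x i ∈ Finset.Icc 2 n) (hn : 1 ≤ n) {g : ℕ → Fin (ℓ + 1)}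
    (hg : ∀ d ∈ Finset.Icc 1 n \ Finset.univ.image x, d < prolong x (n + 1) (g d) ∧
      ∀ j, d < prolong x (n + 1) j → g d ≤ j) : IsNextOutside (Finset.Icc 1 (n + 1))
    (Finset.Icc 1 n \ Finset.univ.image x) (fun d => prolong x (n + 1) (g d)) := by
  intro d hd
  have h1 := Finset.mem_Icc.1 (prolong_mem_Icc hxn hn (g d))
  have h0 := Finset.mem_Icc.1 (Finset.mem_sdiff.1 hd).1
  refine ⟨Finset.mem_Icc.2 ⟨by dsimp only; omega, h1.2⟩, ?_, (hg d hd).1, ?_⟩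
  · rw [mem_compl_iff_prolong]
    exact fun h => h.2 _ rfl
  · intro z hz1 hz2
    dsimp only at hz2
    rw [mem_compl_iff_prolong, Finset.mem_Icc]
    refine ⟨by omega, ?_⟩
    rintro j rfl
    have := (prolong_strictMono' hx hxn).monotone ((hg d hd).2 j hz1)
    omega

theorem one_mem_compl (hxn : ∀ i, x i ∈ Finset.Icc 2 n) (hn : 1 ≤ n) : 1 ∈ Finset.Icc 1 n \ Finset.univ.image x := by
  rw [mem_compl_iff_prolong, Finset.mem_Icc]
  refine ⟨by omega, fun i hi => ?_⟩
  have := Finset.mem_Icc.1 (prolong_mem_Icc hxn hn i)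
  omega

theorem gap_index_one (hxn : ∀ i, x i ∈ Finset.Icc 2 n) (hn : 1 ≤ n) {g : ℕ → Fin (ℓ + 1)}
    (hg : ∀ d ∈ Finset.Icc 1 n \ Finset.univ.image x, d < prolong x (n + 1) (g d) ∧
      ∀ j, d < prolong x (n + 1) j → g d ≤ j) : g 1 = 0 := by
  have := (hg 1 (one_mem_compl hxn hn)).2 0 (by
    have := Finset.mem_Icc.1 (prolong_mem_Icc hxn hn 0)
    omega)
  simpa using this

theorem card_gap (hx : StrictMono x) (hxn : ∀ i, x i ∈ Finset.Icc 2 n) {g : ℕ → Fin (ℓ + 1)}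
    (hg : ∀ d ∈ Finset.Icc 1 n \ Finset.univ.image x, d < prolong x (n + 1) (g d) ∧
      ∀ j, d < prolong x (n + 1) j → g d ≤ j) (j : Fin ℓ) :
    ((Finset.Icc 1 n \ Finset.univ.image x).filter (g · = j.succ)).card =
      prolong x (n + 1) j.succ - x j - 1 := by
  rw [← Nat.card_Ioo]
  congr 1
  ext d
  have hmono := prolong_strictMono' hx hxn
  have hj : prolong x (n + 1) j.castSucc = x j := by rw [prolong, Fin.snoc_castSucc]
  have h1 := Finset.mem_Icc.1 (hxn j)
  rw [Finset.mem_filter, Finset.mem_Ioo]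
  constructor
  · rintro ⟨hd, hgd⟩
    have h2 := hg d hd
    rw [hgd] at h2
    refine ⟨?_, h2.1⟩
    by_contra hle
    rcases (not_lt.1 hle).lt_or_eq with h | h
    · have := h2.2 j.castSucc (by rwa [hj])
      exact absurd this (not_le.2 Fin.castSucc_lt_succ)
    · exact ((mem_compl_iff_prolong d).1 hd).2 j.castSucc (by rw [hj, h])
  · rintro ⟨h2, h3⟩
    have h4 : prolong x (n + 1) j.succ ≤ n + 1 := by
      have := hmono.monotone (Fin.le_last j.succ)
      rwa [prolong, Fin.snoc_last] at this
    have hd : d ∈ Finset.Icc 1 n \ Finset.univ.image x := by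
      rw [mem_compl_iff_prolong, Finset.mem_Icc]
      refine ⟨by omega, ?_⟩
      rintro i rfl
      rw [← hj] at h2
      have := hmono.lt_iff_lt.1 h2
      have := hmono.lt_iff_lt.1 h3
      rw [Fin.lt_def, Fin.val_castSucc] at *
      rw [Fin.val_succ] at this
      omega
    refine ⟨hd, le_antisymm ((hg d hd).2 _ h3) ?_⟩
    have := (hg d hd).1
    rw [← hj] at h2
    exact Fin.castSucc_lt_iff_succ_le.1 (hmono.lt_iff_lt.1 (h2.trans this))

end gaps

section counts

variable {ℓ n : ℕ} {x : Fin ℓ → ℕ}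

/-- The single copy of x_1 becomes the entry of index 0, so that every gap has one supply bound of
the same form. -/
theorem supply_eq (t : Fin ℓ → ℕ) (n : ℕ) (D : Finset ℕ) (x : Fin ℓ → ℕ) :
    supply t n D x = D.val + ∑ i : Fin (ℓ + 1),
      Multiset.replicate ((Fin.cons 1 fun j => t j - 2 : Fin (ℓ + 1) → ℕ) i)
        (prolong x (n + 1) i) := by
  rw [supply, Fin.sum_univ_succ]
  simp

theorem sum_replicate_fiberwise {ι : Type*} [Fintype ι] [DecidableEq ι] (D : Finset ℕ)
    (g : ℕ → ι) (y : ι → ℕ) (e : ℕ → ℕ) :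
    ∑ d ∈ D, Multiset.replicate (e d) (y (g d)) =
      ∑ i, Multiset.replicate (∑ d ∈ D.filter (g · = i), e d) (y i) := by
  rw [← Finset.sum_fiberwise D g]
  refine Finset.sum_congr rfl fun i _ => ?_
  have hrep : ∀ A : Finset ℕ, ∑ d ∈ A, Multiset.replicate (e d) (y i) =
      Multiset.replicate (∑ d ∈ A, e d) (y i) := by
    intro A
    exact (map_sum (Multiset.replicateAddMonoidHom (y i)) e A).symm
  rw [← hrep]
  refine Finset.sum_congr rfl fun d hd => ?_
  rw [(Finset.mem_filter.1 hd).2]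

theorem support_filter_subset {ι : Type*} [DecidableEq ι] {D : Finset ℕ} {e : ℕ →₀ ℕ}
    (he : e.support ⊆ D) (g : ℕ → ι) (i : ι) :
    (e.filter (g · = i)).support ⊆ D.filter (g · = i) := by
  rw [Finsupp.support_filter]
  exact Finset.filter_subset_filter _ he

theorem sum_filter_apply {ι : Type*} [DecidableEq ι] (D : Finset ℕ) (e : ℕ →₀ ℕ) (g : ℕ → ι)
    (i : ι) : ∑ d ∈ D.filter (g · = i), e.filter (g · = i) d = ∑ d ∈ D.filter (g · = i), e d :=
  Finset.sum_congr rfl fun _ hd => Finsupp.filter_apply_pos _ _ (Finset.mem_filter.1 hd).2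

theorem filter_eq_single_one_iff {D : Finset ℕ} {e : ℕ →₀ ℕ} (he : e.support ⊆ D)
    {g : ℕ → Fin (ℓ + 1)} (h1 : 1 ∈ D) (hg1 : g 1 = 0) :
    e.filter (g · = 0) = Finsupp.single 1 1 ↔ ∑ d ∈ D.filter (g · = 0), e d ≤ 1 ∧ 1 ≤ e 1 := by
  rw [← sum_le_one_and_pos_iff (Finset.mem_filter.2 ⟨h1, hg1⟩) (support_filter_subset he g 0),
    sum_filter_apply, Finsupp.filter_apply_pos (g · = 0) e hg1]

/-- By `exists_eq_segFamily` the families are multiplicity functions on D. The supply bounds the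
total multiplicity in each later gap by `t j - 2`, a stars-and-bars count with slack; the first gap
is rigid. -/
theorem ncard_partition_families (hx : StrictMono x) (hxn : ∀ i, x i ∈ Finset.Icc 2 n)
    (hn : 1 ≤ n) (t : Fin ℓ → ℕ) :
    {F : Finset (Multiset ℕ) | (∀ C ∈ F, C ≠ 0) ∧ Segmented (Finset.Icc 1 (n + 1)) F ∧
      famMin F = ↑(Finset.Icc 1 n \ Finset.univ.image x) ∧ famRel F (prolong x (n + 1) 0) 1 ∧
      famSum F ≤ supply t n (Finset.Icc 1 n \ Finset.univ.image x) x}.ncard =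
    ∏ j : Fin ℓ, (t j - 2 + (prolong x (n + 1) j.succ - x j - 1)).choose
      (prolong x (n + 1) j.succ - x j - 1) := by
  obtain ⟨g, hg⟩ := exists_gap_index n x
  have hs := isNextOutside_prolong hx hxn hn hg
  have h1D := one_mem_compl hxn hn
  have hg1 := gap_index_one hxn hn hg
  have hinj := (prolong_strictMono' hx hxn).injective
  have hT : ∀ z ∈ ∑ i : Fin (ℓ + 1),
      Multiset.replicate ((Fin.cons 1 fun j => t j - 2 : Fin (ℓ + 1) → ℕ) i)
        (prolong x (n + 1) i), z ∉ Finset.Icc 1 n \ Finset.univ.image x := by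
    intro z hz
    obtain ⟨i, -, hi⟩ := Multiset.mem_sum.1 hz
    rw [Multiset.eq_of_mem_replicate hi, mem_compl_iff_prolong]
    exact fun h => h.2 i rfl
  have hcard := card_gap hx hxn hg
  have hDU : Finset.Icc 1 n \ Finset.univ.image x ⊆ Finset.Icc 1 (n + 1) := fun v hv =>
    ((mem_compl_iff_prolong v).1 hv).1
  set D := Finset.Icc 1 n \ Finset.univ.image x with hD
  let Q : Fin (ℓ + 1) → Finset (ℕ →₀ ℕ) := Fin.cons {Finsupp.single 1 1} fun j =>
    sumLE (D.filter (g · = j.succ)) (t j - 2)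
  have hset : {F : Finset (Multiset ℕ) | (∀ C ∈ F, C ≠ 0) ∧ Segmented (Finset.Icc 1 (n + 1)) F ∧
      famMin F = ↑D ∧ famRel F (prolong x (n + 1) 0) 1 ∧ famSum F ≤ supply t n D x} =
      segFamily D (fun d => prolong x (n + 1) (g d)) ''
        {e : ℕ →₀ ℕ | e.support ⊆ D ∧ ∀ i, e.filter (g · = i) ∈ Q i} := by
    have key : ∀ e : ℕ →₀ ℕ, e.support ⊆ D →
        (((∀ C ∈ segFamily D (fun d => prolong x (n + 1) (g d)) e, C ≠ 0) ∧
          Segmented (Finset.Icc 1 (n + 1)) (segFamily D (fun d => prolong x (n + 1) (g d)) e) ∧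
          famMin (segFamily D (fun d => prolong x (n + 1) (g d)) e) = ↑D ∧
          famRel (segFamily D (fun d => prolong x (n + 1) (g d)) e) (prolong x (n + 1) 0) 1 ∧
          famSum (segFamily D (fun d => prolong x (n + 1) (g d)) e) ≤ supply t n D x) ↔
        ∀ i, e.filter (g · = i) ∈ Q i) := by
      intro e he
      have hr := famRel_segFamily hs e h1D
      simp only [hg1] at hr
      rw [hr, famSum_segFamily hs, supply_eq, add_le_add_iff_left, sum_replicate_fiberwise,
        sum_replicate_le_iff hinj, Fin.forall_fin_succ, Fin.forall_fin_succ]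
      simp only [Q, Fin.cons_zero, Fin.cons_succ, Finset.mem_singleton, mem_sumLE,
        filter_eq_single_one_iff he h1D hg1, sum_filter_apply, support_filter_subset he,
        true_and]
      constructor
      · rintro ⟨-, -, -, h1, h2, h3⟩
        exact ⟨⟨h2, h1⟩, h3⟩
      · rintro ⟨⟨h2, h1⟩, h3⟩
        exact ⟨fun C hC => ne_zero_of_mem_segFamily hC, segmented_segFamily hs hDU e,
          famMin_segFamily hs e, h1, h2, h3⟩
    ext F
    constructor
    · intro hF
      obtain ⟨h1, h2, h3, h4, h5⟩ := id hF
      rw [supply_eq] at h5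
      obtain ⟨e, he, rfl⟩ := exists_eq_segFamily hs hT h1 h2 h3 h5
      exact ⟨e, ⟨he, (key e he).1 hF⟩, rfl⟩
    · rintro ⟨e, ⟨he, h⟩, rfl⟩
      exact (key e he).2 h
  rw [hset, Set.InjOn.ncard_image, ncard_finsupp_of_fibers, Fin.prod_univ_succ]
  · simp only [Q, Fin.cons_zero, Fin.cons_succ, Finset.card_singleton, one_mul, card_sumLE, hcard]
  · intro i f hf
    induction i using Fin.cases with
    | zero =>
      rw [Finset.mem_singleton.1 hf]
      exact Finsupp.support_single_subset.trans
        (Finset.singleton_subset_iff.2 (Finset.mem_filter.2 ⟨h1D, hg1⟩))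
    | succ j => exact (mem_sumLE.1 hf).1
  · intro e he e' he' h
    exact segFamily_injective hs he.1 he'.1 h

/-- For sets the multiplicities are 0 or 1, and equality with the supply fixes their sum, so each
later gap contributes the choice of a subset of size `t j - 2`. -/
theorem ncard_permutation_families (hx : StrictMono x) (hxn : ∀ i, x i ∈ Finset.Icc 2 n)
    (hn : 1 ≤ n) (t : Fin ℓ → ℕ) :
    {F : Finset (Multiset ℕ) | (∀ C ∈ F, C ≠ 0 ∧ C.Nodup) ∧
      Segmented (Finset.Icc 1 (n + 1)) F ∧
      famMin F = ↑(Finset.Icc 1 n \ Finset.univ.image x) ∧ famRel F (prolong x (n + 1) 0) 1 ∧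
      famSum F = supply t n (Finset.Icc 1 n \ Finset.univ.image x) x}.ncard =
    ∏ j : Fin ℓ, (prolong x (n + 1) j.succ - x j - 1).choose (t j - 2) := by
  obtain ⟨g, hg⟩ := exists_gap_index n x
  have hs := isNextOutside_prolong hx hxn hn hg
  have h1D := one_mem_compl hxn hn
  have hg1 := gap_index_one hxn hn hg
  have hinj := (prolong_strictMono' hx hxn).injective
  have hT : ∀ z ∈ ∑ i : Fin (ℓ + 1),
      Multiset.replicate ((Fin.cons 1 fun j => t j - 2 : Fin (ℓ + 1) → ℕ) i)
        (prolong x (n + 1) i), z ∉ Finset.Icc 1 n \ Finset.univ.image x := by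
    intro z hz
    obtain ⟨i, -, hi⟩ := Multiset.mem_sum.1 hz
    rw [Multiset.eq_of_mem_replicate hi, mem_compl_iff_prolong]
    exact fun h => h.2 i rfl
  have hcard := card_gap hx hxn hg
  have hDU : Finset.Icc 1 n \ Finset.univ.image x ⊆ Finset.Icc 1 (n + 1) := fun v hv =>
    ((mem_compl_iff_prolong v).1 hv).1
  set D := Finset.Icc 1 n \ Finset.univ.image x with hD
  let Q : Fin (ℓ + 1) → Finset (ℕ →₀ ℕ) := Fin.cons {Finsupp.single 1 1} fun j =>
    zeroOneSum (D.filter (g · = j.succ)) (t j - 2)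
  have hset : {F : Finset (Multiset ℕ) | (∀ C ∈ F, C ≠ 0 ∧ C.Nodup) ∧
      Segmented (Finset.Icc 1 (n + 1)) F ∧
      famMin F = ↑D ∧ famRel F (prolong x (n + 1) 0) 1 ∧ famSum F = supply t n D x} =
      segFamily D (fun d => prolong x (n + 1) (g d)) ''
        {e : ℕ →₀ ℕ | e.support ⊆ D ∧ ∀ i, e.filter (g · = i) ∈ Q i} := by
    have key : ∀ e : ℕ →₀ ℕ, e.support ⊆ D →
        (((∀ C ∈ segFamily D (fun d => prolong x (n + 1) (g d)) e, C ≠ 0 ∧ C.Nodup) ∧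
          Segmented (Finset.Icc 1 (n + 1)) (segFamily D (fun d => prolong x (n + 1) (g d)) e) ∧
          famMin (segFamily D (fun d => prolong x (n + 1) (g d)) e) = ↑D ∧
          famRel (segFamily D (fun d => prolong x (n + 1) (g d)) e) (prolong x (n + 1) 0) 1 ∧
          famSum (segFamily D (fun d => prolong x (n + 1) (g d)) e) = supply t n D x) ↔
        ∀ i, e.filter (g · = i) ∈ Q i) := by
      intro e he
      have hr := famRel_segFamily hs e h1D
      simp only [hg1] at hr
      have hnd : (∀ C ∈ segFamily D (fun d => prolong x (n + 1) (g d)) e, C ≠ 0 ∧ C.Nodup) ↔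
          ∀ d ∈ D, e d ≤ 1 := by
        rw [← nodup_segFamily_iff hs]
        exact forall₂_congr fun C hC => and_iff_right (ne_zero_of_mem_segFamily hC)
      have hle : ∀ j, (∀ d ∈ D.filter (g · = Fin.succ j),
          e.filter (g · = Fin.succ j) d ≤ 1) ↔ ∀ d ∈ D, g d = Fin.succ j → e d ≤ 1 := by
        intro j
        simp only [Finset.mem_filter, and_imp]
        refine forall₂_congr fun d _ => forall_congr' fun h => ?_
        rw [Finsupp.filter_apply_pos (g · = Fin.succ j) e h]
      rw [hr, hnd, famSum_segFamily hs, supply_eq, add_right_inj, sum_replicate_fiberwise,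
        sum_replicate_eq_iff hinj, Fin.forall_fin_succ, Fin.forall_fin_succ]
      simp only [Q, Fin.cons_zero, Fin.cons_succ, Finset.mem_singleton, mem_zeroOneSum,
        filter_eq_single_one_iff he h1D hg1, sum_filter_apply, support_filter_subset he,
        true_and, hle]
      constructor
      · rintro ⟨h0, -, -, h1, h2, h3⟩
        exact ⟨⟨h2.le, h1⟩, fun j => ⟨h3 j, fun d hd _ => h0 d hd⟩⟩
      · rintro ⟨⟨h2, h1⟩, h3⟩
        -- In the first gap the sum is at most 1 while the term at 1 is positive, which yields the
        -- required equality.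
        have h1gap : 1 ∈ D.filter (g · = 0) := Finset.mem_filter.2 ⟨h1D, hg1⟩
        refine ⟨fun d hd => ?_, segmented_segFamily hs hDU e, famMin_segFamily hs e, h1,
          le_antisymm h2 (h1.trans (Finset.single_le_sum (f := fun d => e d)
            (fun _ _ => Nat.zero_le _) h1gap)), fun j => (h3 j).1⟩
        rcases Fin.eq_zero_or_eq_succ (g d) with h | ⟨j, h⟩
        · exact (Finset.single_le_sum (f := fun d => e d) (fun _ _ => Nat.zero_le _)
            (Finset.mem_filter.2 ⟨hd, h⟩)).trans h2
        · exact (h3 j).2 d hd h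
    ext F
    constructor
    · intro hF
      obtain ⟨h1, h2, h3, h4, h5⟩ := id hF
      rw [supply_eq] at h5
      obtain ⟨e, he, rfl⟩ := exists_eq_segFamily hs hT (fun C hC => (h1 C hC).1) h2 h3 h5.le
      exact ⟨e, ⟨he, (key e he).1 hF⟩, rfl⟩
    · rintro ⟨e, ⟨he, h⟩, rfl⟩
      exact (key e he).2 h
  rw [hset, Set.InjOn.ncard_image, ncard_finsupp_of_fibers, Fin.prod_univ_succ]
  · simp only [Q, Fin.cons_zero, Fin.cons_succ, Finset.card_singleton, one_mul, card_zeroOneSum,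
      hcard]
  · intro i f hf
    induction i using Fin.cases with
    | zero =>
      rw [Finset.mem_singleton.1 hf]
      exact Finsupp.support_single_subset.trans
        (Finset.singleton_subset_iff.2 (Finset.mem_filter.2 ⟨h1D, hg1⟩))
    | succ j => exact (mem_zeroOneSum.1 hf).1
  · intro e he e' he' h
    exact segFamily_injective hs he.1 he'.1 h

end counts

/-- All blocks are submultisets of `T`. Finiteness is needed for the additivity of `Set.ncard`. -/
theorem finite_setOf_famSum_le (T : Multiset ℕ) : {F | famSum F ≤ T}.Finite := by
  classical
  refine (T.powerset.toFinset.powerset.finite_toSet).subset fun F hF => ?_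
  rw [Finset.mem_coe, Finset.mem_powerset]
  intro C hC
  rw [Multiset.mem_toFinset, Multiset.mem_powerset]
  exact (Finset.single_le_sum (f := fun C : Multiset ℕ => C) (fun _ _ => zero_le) hC).trans hF

/-! ### Counting systems -/

/-- A union of products indexed by `X`; it is disjoint because the component at `j₀` determines the
index. -/
theorem ncard_setOf_exists_mem_pi {ι α β J : Type*} [Fintype J] [Finite β] (X : Finset ι)
    (A : ι → Set α) (E : ι → J → Set β) (hA : ∀ x ∈ X, (A x).Finite) (j₀ : J)
    (hE : ∀ x ∈ X, ∀ x' ∈ X, ∀ y, y ∈ E x j₀ → y ∈ E x' j₀ → x = x') :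
    {p : α × (J → β) | ∃ x ∈ X, p.1 ∈ A x ∧ ∀ j, p.2 j ∈ E x j}.ncard =
      ∑ x ∈ X, (A x).ncard * ∏ j, (E x j).ncard := by
  classical
  have hpi : ∀ x, (Set.univ.pi (E x)).ncard = ∏ j, (E x j).ncard := by
    intro x
    rw [← Nat.card_coe_set_eq, Nat.card_congr (Equiv.Set.univPi (E x)), Nat.card_pi]
    rfl
  have hset : {p : α × (J → β) | ∃ x ∈ X, p.1 ∈ A x ∧ ∀ j, p.2 j ∈ E x j} =
      ⋃ x ∈ X, A x ×ˢ Set.univ.pi (E x) := by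
    ext p
    simp only [Set.mem_ofPred_eq, Set.mem_iUnion, Set.mem_prod, Set.mem_univ_pi, exists_prop]
  have hfin : ∀ x ∈ X, (A x ×ˢ Set.univ.pi (E x)).Finite := fun x hx =>
    (hA x hx).prod (Set.toFinite _)
  rw [hset]
  clear hset
  induction X using Finset.induction_on with
  | empty => simp
  | insert x X hxX ih =>
    have hU : (⋃ y ∈ X, A y ×ˢ Set.univ.pi (E y)).Finite :=
      X.finite_toSet.biUnion fun y hy => hfin y (Finset.mem_insert_of_mem hy)
    rw [Finset.sum_insert hxX, Finset.set_biUnion_insert, Set.ncard_union_eq ?_ (hfin x (Finset.mem_insert_self _ _))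
      hU, Set.ncard_prod, hpi,
      ih (fun y hy => hA y (Finset.mem_insert_of_mem hy))
        (fun y hy y' hy' => hE y (Finset.mem_insert_of_mem hy) y' (Finset.mem_insert_of_mem hy'))
        (fun y hy => hfin y (Finset.mem_insert_of_mem hy))]
    · rw [Set.disjoint_left]
      rintro p hp hp'
      simp only [Set.mem_iUnion] at hp'
      obtain ⟨y, hy, hp'⟩ := hp'
      have := hE x (Finset.mem_insert_self _ _) y (Finset.mem_insert_of_mem hy) (p.2 j₀)
        (hp.2 j₀ trivial) (hp'.2 j₀ trivial)
      exact hxX (this ▸ hy)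

/-- The i-th nonminimum is free in exactly the first `a i` of the M components and frozen in the
others. -/
theorem prod_prod_ite_lt {ℓ : ℕ} (a c : Fin ℓ → ℕ) :
    ∏ j : Fin (maxA a), ∏ i, (if a i < j.val + 1 then 1 else c i) = ∏ i, c i ^ a i := by
  rw [Finset.prod_comm]
  refine Finset.prod_congr rfl fun i _ => ?_
  have hle : a i ≤ maxA a := Finset.le_sup (Finset.mem_univ i)
  rw [← Finset.prod_range fun j => if a i < j + 1 then 1 else c i, Finset.prod_ite,
    Finset.prod_const_one, one_mul, Finset.prod_const]
  congr 1
  have : (Finset.range (maxA a)).filter (fun j => ¬ a i < j + 1) = Finset.range (a i) := by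
    ext j
    simp only [Finset.mem_filter, Finset.mem_range]
    omega
  rw [this, Finset.card_range]

/-- The strictly increasing sequences with terms in `{2, …, n}`. -/
noncomputable def nonMinSeqs (ℓ n : ℕ) : Finset (Fin ℓ → ℕ) :=
  open Classical in (Fintype.piFinset fun _ => Finset.Icc 2 n).filter StrictMono

theorem mem_nonMinSeqs {ℓ n : ℕ} {x : Fin ℓ → ℕ} :
    x ∈ nonMinSeqs ℓ n ↔ (∀ i, x i ∈ Finset.Icc 2 n) ∧ StrictMono x := by
  simp only [nonMinSeqs, Finset.mem_filter, Fintype.mem_piFinset]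

theorem card_compl_image {ℓ n : ℕ} {x : Fin ℓ → ℕ} (hx : x ∈ nonMinSeqs ℓ n) :
    (Finset.Icc 1 n \ Finset.univ.image x).card = n - ℓ ∧
      Enumerates n (Finset.Icc 1 n \ Finset.univ.image x) x := by
  rw [mem_nonMinSeqs] at hx
  have hsub : Finset.univ.image x ⊆ Finset.Icc 1 n := by
    intro v hv
    obtain ⟨i, -, rfl⟩ := Finset.mem_image.1 hv
    have := Finset.mem_Icc.1 (hx.1 i)
    exact Finset.mem_Icc.2 ⟨by omega, this.2⟩
  refine ⟨?_, hx.2, ?_⟩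
  · rw [Finset.card_sdiff_of_subset hsub, Finset.card_image_of_injective _ hx.2.injective]
    simp
  · rw [Finset.sdiff_sdiff_eq_self hsub]

theorem eq_of_compl_image_eq {ℓ n : ℕ} {x x' : Fin ℓ → ℕ} (hx : x ∈ nonMinSeqs ℓ n)
    (hx' : x' ∈ nonMinSeqs ℓ n)
    (h : Finset.Icc 1 n \ Finset.univ.image x = Finset.Icc 1 n \ Finset.univ.image x') :
    x = x' := by
  have h1 := (card_compl_image hx).2.2
  have h2 := (card_compl_image hx').2.2
  rw [h, ← h2] at h1
  refine (StrictMono.range_inj (mem_nonMinSeqs.1 hx).2 (mem_nonMinSeqs.1 hx').2).1 ?_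
  have := congrArg (fun s : Finset ℕ => (s : Set ℕ)) h1
  simpa using this

/-- Since 1 is always a minimum, the nonminima start at 2. -/
theorem mem_nonMinSeqs_of_enumerates {ℓ n : ℕ} {D : Finset ℕ} {x : Fin ℓ → ℕ}
    (h : Enumerates n D x) (hDs : D ⊆ Finset.Icc 1 n) (h1 : 1 ≤ n → 1 ∈ D) :
    x ∈ nonMinSeqs ℓ n ∧ D = Finset.Icc 1 n \ Finset.univ.image x := by
  refine ⟨mem_nonMinSeqs.2 ⟨fun i => ?_, h.1⟩, ?_⟩
  · have hi : x i ∈ Finset.Icc 1 n \ D := by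
      rw [← h.2]
      exact Finset.mem_image_of_mem _ (Finset.mem_univ i)
    obtain ⟨h2, h3⟩ := Finset.mem_sdiff.1 hi
    rw [Finset.mem_Icc] at h2 ⊢
    have : x i ≠ 1 := fun e => h3 (e ▸ h1 (by omega))
    omega
  · rw [h.2, Finset.sdiff_sdiff_eq_self hDs]

theorem maxA_pos {ℓ : ℕ} (hℓ : 0 < ℓ) {a : Fin ℓ → ℕ} (ha : ∀ j, 0 < a j) : 0 < maxA a :=
  (ha ⟨0, hℓ⟩).trans_le (Finset.le_sup (f := a) (Finset.mem_univ _))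

/-- Positivity of `ℓ` and of the `a j` gives M ≥ 1, so there is a component π_1 whose block minima
determine D and hence the sequence `x`. -/
theorem partitionSystems_eq_sum {ℓ : ℕ} (hℓ : 0 < ℓ) {a : Fin ℓ → ℕ} (ha : ∀ j, 0 < a j)
    (t : Fin ℓ → ℕ) (n m : ℕ) (hnm : n = ℓ + m) :
    partitionSystems a t n m = ∑ x ∈ nonMinSeqs ℓ n,
      (∏ i, (x i - 1 - i.val) ^ a i) *
        ∏ j : Fin ℓ, (t j - 2 + (prolong x (n + 1) j.succ - x j - 1)).choose
          (prolong x (n + 1) j.succ - x j - 1) := by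
  have hset : {p : Finset (Multiset ℕ) × (Fin (maxA a) → Finpartition (Finset.Icc 1 n)) |
      IsPartitionSystem a t n m p.1 p.2} =
      {p | ∃ x ∈ nonMinSeqs ℓ n, p.1 ∈ {F : Finset (Multiset ℕ) | (∀ C ∈ F, C ≠ 0) ∧
        Segmented (Finset.Icc 1 (n + 1)) F ∧
        famMin F = ↑(Finset.Icc 1 n \ Finset.univ.image x) ∧ famRel F (prolong x (n + 1) 0) 1 ∧
        famSum F ≤ supply t n (Finset.Icc 1 n \ Finset.univ.image x) x} ∧
        ∀ j, p.2 j ∈ {π : Finpartition (Finset.Icc 1 n) |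
          famMin (blocks π) = ↑(Finset.Icc 1 n \ Finset.univ.image x) ∧
          ∀ i, a i < j.val + 1 → famRel (blocks π) (x i) 1}} := by
    ext ⟨F, π⟩
    constructor
    · rintro ⟨D, x, h1, -, h3, h4, h5⟩
      have h1' := h1 ⟨0, maxA_pos hℓ ha⟩
      obtain ⟨hx, rfl⟩ := mem_nonMinSeqs_of_enumerates h3 (fun v hv => by
          rw [← Finset.mem_coe, ← h1', famMin_blocks_eq] at hv
          obtain ⟨u, hu, rfl⟩ := hv
          exact blockMin_mem _ hu)
        (fun hn => by
          have hmem : 1 ∈ Finset.Icc 1 n := Finset.mem_Icc.2 ⟨le_rfl, hn⟩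
          have h := blockMin_mem_famMin (π ⟨0, maxA_pos hℓ ha⟩) hmem
          have h2 := blockMin_le (π ⟨0, maxA_pos hℓ ha⟩) hmem
          have h3 := Finset.mem_Icc.1 (blockMin_mem (π ⟨0, maxA_pos hℓ ha⟩) hmem)
          rw [h1', Finset.mem_coe] at h
          rwa [show 1 = blockMin (π ⟨0, maxA_pos hℓ ha⟩) 1 by omega])
      exact ⟨x, hx, h5, fun j => ⟨h1 j, fun i => h4 i j⟩⟩
    · rintro ⟨x, hx, h5, h⟩
      have hc := card_compl_image hx
      exact ⟨_, x, fun j => (h j).1, by rw [hc.1]; omega, hc.2, fun i j => (h j).2 i, h5⟩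
  rw [partitionSystems, hset, ncard_setOf_exists_mem_pi (nonMinSeqs ℓ n)
    (fun x => {F : Finset (Multiset ℕ) | (∀ C ∈ F, C ≠ 0) ∧
      Segmented (Finset.Icc 1 (n + 1)) F ∧
      famMin F = ↑(Finset.Icc 1 n \ Finset.univ.image x) ∧ famRel F (prolong x (n + 1) 0) 1 ∧
      famSum F ≤ supply t n (Finset.Icc 1 n \ Finset.univ.image x) x})
    (fun x (j : Fin (maxA a)) => {π : Finpartition (Finset.Icc 1 n) |
          famMin (blocks π) = ↑(Finset.Icc 1 n \ Finset.univ.image x) ∧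
          ∀ i, a i < j.val + 1 → famRel (blocks π) (x i) 1})
    (fun x _ => (finite_setOf_famSum_le _).subset fun F hF => hF.2.2.2.2) ⟨0, maxA_pos hℓ ha⟩]
  · refine Finset.sum_congr rfl fun x hx => ?_
    obtain ⟨h1, h2⟩ := mem_nonMinSeqs.1 hx
    rw [ncard_partition_families h2 h1 (by omega), mul_comm, ← prod_prod_ite_lt]
    congr 1
    exact Finset.prod_congr rfl fun j _ => ncard_partitions_of_famMin h2 h1 _
  · rintro x hx x' hx' π ⟨h, -⟩ ⟨h', -⟩
    exact eq_of_compl_image_eq hx hx' (Finset.coe_injective (h.symm.trans h'))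

theorem permutationSystems_eq_sum {ℓ : ℕ} (hℓ : 0 < ℓ) {a : Fin ℓ → ℕ} (ha : ∀ j, 0 < a j)
    (t : Fin ℓ → ℕ) (n : ℕ) (hn : ℓ ≤ n) :
    permutationSystems a t n (n - ℓ) = ∑ x ∈ nonMinSeqs ℓ n,
      (∏ i, (x i - 1) ^ a i) *
        ∏ j : Fin ℓ, (prolong x (n + 1) j.succ - x j - 1).choose (t j - 2) := by
  have hset : {p : Finset (Multiset ℕ) × (Fin (maxA a) → Equiv.Perm (Fin n)) |
      IsPermutationSystem a t n (n - ℓ) p.1 p.2} =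
      {p | ∃ x ∈ nonMinSeqs ℓ n, p.1 ∈ {F : Finset (Multiset ℕ) |
        (∀ C ∈ F, C ≠ 0 ∧ C.Nodup) ∧ Segmented (Finset.Icc 1 (n + 1)) F ∧
        famMin F = ↑(Finset.Icc 1 n \ Finset.univ.image x) ∧ famRel F (prolong x (n + 1) 0) 1 ∧
        famSum F = supply t n (Finset.Icc 1 n \ Finset.univ.image x) x} ∧
        ∀ j, p.2 j ∈ {σ : Equiv.Perm (Fin n) |
          lmin σ = ↑(Finset.Icc 1 n \ Finset.univ.image x) ∧
          ∀ i, a i < j.val + 1 →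
            ∀ p, (σ p).val + 1 = x i → ∀ q, p < q → x i < (σ q).val + 1}} := by
    ext ⟨F, σ⟩
    constructor
    · rintro ⟨D, x, h1, -, h3, h4, h5⟩
      have h1' := h1 ⟨0, maxA_pos hℓ ha⟩
      obtain ⟨hx, rfl⟩ := mem_nonMinSeqs_of_enumerates h3 (fun v hv => by
          rw [← Finset.mem_coe, ← h1'] at hv
          obtain ⟨p, rfl, -⟩ := hv
          have := (σ ⟨0, maxA_pos hℓ ha⟩ p).isLt
          exact Finset.mem_Icc.2 ⟨by omega, by omega⟩)
        (fun hn => by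
          rw [← Finset.mem_coe, ← h1']
          -- The letter 1 has its code in `Fin 1`, so it is a left-to-right minimum.
          refine (insertionCode_eq_zero_iff (v := ⟨0, by omega⟩)).1 ?_
          exact Subsingleton.elim (α := Fin 1) _ _)
      exact ⟨x, hx, h5, fun j => ⟨h1 j, fun i => h4 i j⟩⟩
    · rintro ⟨x, hx, h5, h⟩
      have hc := card_compl_image hx
      exact ⟨_, x, fun j => (h j).1, hc.1, hc.2, fun i j => (h j).2 i, h5⟩
  rw [permutationSystems, hset, ncard_setOf_exists_mem_pi (nonMinSeqs ℓ n)
    (fun x => {F : Finset (Multiset ℕ) | (∀ C ∈ F, C ≠ 0 ∧ C.Nodup) ∧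
      Segmented (Finset.Icc 1 (n + 1)) F ∧
      famMin F = ↑(Finset.Icc 1 n \ Finset.univ.image x) ∧ famRel F (prolong x (n + 1) 0) 1 ∧
      famSum F = supply t n (Finset.Icc 1 n \ Finset.univ.image x) x})
    (fun x (j : Fin (maxA a)) => {σ : Equiv.Perm (Fin n) |
          lmin σ = ↑(Finset.Icc 1 n \ Finset.univ.image x) ∧
          ∀ i, a i < j.val + 1 →
            ∀ p, (σ p).val + 1 = x i → ∀ q, p < q → x i < (σ q).val + 1})
    (fun x _ => (finite_setOf_famSum_le _).subset fun F hF => hF.2.2.2.2.le) ⟨0, maxA_pos hℓ ha⟩]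
  · refine Finset.sum_congr rfl fun x hx => ?_
    obtain ⟨h1, h2⟩ := mem_nonMinSeqs.1 hx
    rw [ncard_permutation_families h2 h1 (by omega), mul_comm, ← prod_prod_ite_lt]
    congr 1
    exact Finset.prod_congr rfl fun j _ => ncard_permutations_of_lmin h2 h1 _
  · rintro x hx x' hx' σ ⟨h, -⟩ ⟨h', -⟩
    exact eq_of_compl_image_eq hx hx' (Finset.coe_injective (h.symm.trans h'))

/-! ### From nonminima to the summation indices -/

theorem add_le_of_strictMono {ℓ : ℕ} {x : Fin ℓ → ℕ} (hx : StrictMono x) :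
    ∀ (d : ℕ) (p q : Fin ℓ), q.val = p.val + d → x p + d ≤ x q := by
  intro d
  induction d with
  | zero =>
    intro p q h
    rw [Fin.ext (h : q.val = p.val)]
    exact le_rfl
  | succ d ih =>
    intro p q h
    have h1 := ih p ⟨p.val + d, by omega⟩ rfl
    have h2 : x ⟨p.val + d, by omega⟩ < x q := hx (Fin.lt_def.2 (by simp only; omega))
    omega

/-- The new index is the number of minima below `x j`. It turns strict into weak monotonicity, sends
the endpoint `ℓ + m + 1` to `m`, and makes gap sizes into differences of consecutive indices. -/
theorem sum_nonMinSeqs_eq_sum_weakSeqs {ℓ : ℕ} (a : Fin ℓ → ℕ) {t : Fin ℓ → ℕ}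
    (ht : ∀ j, 1 < t j) (m : ℕ) :
    ∑ x ∈ nonMinSeqs ℓ (ℓ + m), (∏ i, (x i - 1 - i.val) ^ a i) *
        ∏ j : Fin ℓ, (t j - 2 + (prolong x (ℓ + m + 1) j.succ - x j - 1)).choose
          (prolong x (ℓ + m + 1) j.succ - x j - 1) =
      ∑ i ∈ weakSeqs ℓ m, (∏ j, i j ^ a j) *
        ∏ j : Fin ℓ, (t j + prolong i m j.succ - i j - 2).choose (prolong i m j.succ - i j) := by
  symm
  have hmem : ∀ i : Fin ℓ → ℕ, i ∈ weakSeqs ℓ m ↔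
      (∀ j, 1 ≤ i j ∧ i j ≤ m) ∧ ∀ p q, p < q → i p ≤ i q := by
    intro i
    simp [weakSeqs]
  refine Finset.sum_bij' (fun i _ j => i j + 1 + j.val) (fun x _ j => x j - 1 - j.val)
    ?_ ?_ ?_ ?_ ?_
  · intro i hi
    rw [hmem] at hi
    rw [mem_nonMinSeqs]
    refine ⟨fun j => ?_, fun p q hpq => ?_⟩
    · have := hi.1 j
      rw [Finset.mem_Icc]
      omega
    · have := hi.2 p q hpq
      have := Fin.lt_def.1 hpq
      simp only
      omega
  · intro x hx
    rw [mem_nonMinSeqs] at hx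
    rw [hmem]
    refine ⟨fun j => ?_, fun p q hpq => ?_⟩
    · have hj := j.isLt
      have h1 := Finset.mem_Icc.1 (hx.1 ⟨0, by omega⟩)
      have h2 := Finset.mem_Icc.1 (hx.1 ⟨ℓ - 1, by omega⟩)
      have h3 := add_le_of_strictMono hx.2 j.val ⟨0, by omega⟩ j (by simp)
      have h4 := add_le_of_strictMono hx.2 (ℓ - 1 - j.val) j ⟨ℓ - 1, by omega⟩ (by simp only; omega)
      omega
    · have h0 := Fin.lt_def.1 hpq
      have := add_le_of_strictMono hx.2 (q.val - p.val) p q (by omega)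
      omega
  · intro i _
    funext j
    simp only
    omega
  · intro x hx
    rw [mem_nonMinSeqs] at hx
    funext j
    have hj := j.isLt
    have h1 := Finset.mem_Icc.1 (hx.1 ⟨0, by omega⟩)
    have h3 := add_le_of_strictMono hx.2 j.val ⟨0, by omega⟩ j (by simp)
    simp only
    omega
  · intro i hi
    rw [hmem] at hi
    -- The shift at `j.succ` is 1 + (j + 1), at the endpoint too. The inequality makes the truncated
    -- differences genuine.
    have hp : ∀ j : Fin ℓ, prolong (fun j : Fin ℓ => i j + 1 + j.val) (ℓ + m + 1) j.succ =
        prolong i m j.succ + j.val + 2 ∧ i j ≤ prolong i m j.succ := by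
      intro j
      obtain ⟨ℓ, rfl⟩ : ∃ s, ℓ = s + 1 := ⟨ℓ - 1, by have := j.isLt; omega⟩
      induction j using Fin.lastCases with
      | last =>
        have := (hi.1 (Fin.last ℓ)).2
        simp only [Fin.succ_last, prolong, Fin.snoc_last, Fin.val_last]
        omega
      | cast j =>
        have := hi.2 j.castSucc j.succ Fin.castSucc_lt_succ
        simp only [Fin.succ_castSucc, prolong, Fin.snoc_castSucc, Fin.val_succ, Fin.val_castSucc]
        omega
    congr 1
    · refine Finset.prod_congr rfl fun j _ => ?_
      congr 1
      dsimp only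
      omega
    · refine Finset.prod_congr rfl fun j _ => ?_
      have := hp j
      have := ht j
      dsimp only
      congr 1 <;> omega

/-- Lowering every term by one, the endpoint `n + 1` included, leaves all gaps unchanged. -/
theorem sum_nonMinSeqs_eq_sum_strictSeqs {ℓ : ℕ} (a t : Fin ℓ → ℕ) (n : ℕ) :
    ∑ x ∈ nonMinSeqs ℓ n, (∏ i, (x i - 1) ^ a i) *
        ∏ j : Fin ℓ, (prolong x (n + 1) j.succ - x j - 1).choose (t j - 2) =
      ∑ i ∈ strictSeqs ℓ n, (∏ j, i j ^ a j) *
        ∏ j : Fin ℓ, (prolong i n j.succ - i j - 1).choose (t j - 2) := by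
  symm
  have hmem : ∀ i : Fin ℓ → ℕ, i ∈ strictSeqs ℓ n ↔
      (∀ j, 1 ≤ i j ∧ i j < n) ∧ ∀ p q, p < q → i p < i q := by
    intro i
    simp [strictSeqs]
  refine Finset.sum_bij' (fun i _ j => i j + 1) (fun x _ j => x j - 1) ?_ ?_ ?_ ?_ ?_
  · intro i hi
    rw [hmem] at hi
    rw [mem_nonMinSeqs]
    refine ⟨fun j => ?_, fun p q hpq => ?_⟩
    · have := hi.1 j
      rw [Finset.mem_Icc]
      omega
    · exact Nat.add_lt_add_right (hi.2 p q hpq) 1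
  · intro x hx
    rw [mem_nonMinSeqs] at hx
    rw [hmem]
    refine ⟨fun j => ?_, fun p q hpq => ?_⟩
    · have := Finset.mem_Icc.1 (hx.1 j)
      omega
    · have := hx.2 hpq
      have := Finset.mem_Icc.1 (hx.1 p)
      omega
  · intro i _
    funext j
    simp only
    omega
  · intro x hx
    rw [mem_nonMinSeqs] at hx
    funext j
    have := Finset.mem_Icc.1 (hx.1 j)
    simp only
    omega
  · intro i _
    have hp : ∀ j, prolong (fun j : Fin ℓ => i j + 1) (n + 1) j = prolong i n j + 1 := by
      intro j
      induction j using Fin.lastCases with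
      | last => simp [prolong]
      | cast j => simp [prolong]
    simp only [hp, Nat.add_sub_cancel, Nat.add_sub_add_right]

theorem strictSeqs_eq_empty {ℓ m : ℕ} (h : m < ℓ) : strictSeqs ℓ m = ∅ := by
  rw [Finset.eq_empty_iff_forall_notMem]
  intro i hi
  simp only [strictSeqs, Finset.mem_filter, Fintype.mem_piFinset, Finset.mem_Ico] at hi
  have h1 := hi.1 ⟨0, by omega⟩
  have h2 := hi.1 ⟨ℓ - 1, by omega⟩
  have h3 := add_le_of_strictMono (fun p q hpq => hi.2 p q hpq) (ℓ - 1) ⟨0, by omega⟩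
    ⟨ℓ - 1, by omega⟩ (by simp)
  omega

end KStirling

open KStirling in
theorem theorem3 (k : List ℕ) (ℓ : ℕ) (hℓ : 0 < ℓ) (a t : Fin ℓ → ℕ) (hk : HasWeight k a t 0)
    (m : ℕ) :
    B k m = partitionSystems a t (ℓ + m) m ∧
    partitionSystems a t (ℓ + m) m =
      ∑ i ∈ weakSeqs ℓ m, (∏ j, i j ^ a j) *
        ∏ j : Fin ℓ, (t j + prolong i m j.succ - i j - 2).choose (prolong i m j.succ - i j) ∧
    (ℓ ≤ m → b k m = permutationSystems a t m (m - ℓ) ∧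
      permutationSystems a t m (m - ℓ) =
        ∑ i ∈ strictSeqs ℓ m, (∏ j, i j ^ a j) *
          ∏ j : Fin ℓ, (prolong i m j.succ - i j - 1).choose (t j - 2)) ∧
    (m < ℓ → b k m = 0 ∧
      ∑ i ∈ strictSeqs ℓ m, (∏ j, i j ^ a j) *
        ∏ j : Fin ℓ, (prolong i m j.succ - i j - 1).choose (t j - 2) = 0) := by
  obtain ⟨ha, ht, hk⟩ := hk
  rw [List.replicate_zero, List.append_nil] at hk
  have hk : k = listOfWeight a t := hk
  subst hk
  have hS := (partitionSystems_eq_sum hℓ ha t (ℓ + m) m rfl).trans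
    (sum_nonMinSeqs_eq_sum_weakSeqs a ht m)
  refine ⟨?_, hS, fun hm => ?_, fun hm => ?_⟩
  · rw [hS, B_eq_sum hℓ ha ht]
    rfl
  · have hs := (permutationSystems_eq_sum hℓ ha t m hm).trans
      (sum_nonMinSeqs_eq_sum_strictSeqs a t m)
    refine ⟨?_, hs⟩
    rw [hs, b_eq_sum hℓ ha ht]
    rfl
  · rw [b_eq_sum hℓ ha ht, strictSeqs_eq_empty hm]
    simp
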